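/- Let $n\ge 2$, let $(M^n,g)$ be a smooth Riemannian manifold (Hausdorff, second countable) and let $f\colon M^n\to\mathbb{R}^m$ be an isometric immersion without umbilical points. For an immersion $h\colon M^n\to\mathbb{R}^m$ with second fundamental form $\alpha$ and mean curvature vector $\mathcal{H}=\frac1n\sum_i\alpha(X_i,X_i)$ put $\phi^2=\frac{n}{n-1}\left(\|\alpha\|^2-n\|\mathcal{H}\|^2\right)$, where norms and traces are taken with respect to the metric induced by $h$. A smooth variation of $f$ is a smooth map $F\colon(-\epsilon,\epsilon)\times M^n\to\mathbb{R}^m$, $\epsilon>0$, such that every $f_t=F(t,\cdot)$ is an immersion and $f_0=f$; its variational vector field is $\mathcal{T}=\partial F/\partial t|_{t=0}$, and $\phi_t^2$ denotes the function $\phi^2$ of $f_t$. The variation is an infinitesimal Moebius variation if $\frac{\partial}{\partial t}|_{t=0}\left(\phi_t^2\langle f_{t*}X,f_{t*}Y\rangle\right)=0$ for all tangent vectors $X,Y$. A vector field $\mathcal{T}$ along $f$ is trivial on an open set $U\subset M$ if $\mathcal{T}|_U$ is the restriction of a conformal Killing vector field of $\mathbb{R}^m$. The immersion $f$ is infinitesimally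 Moebius bendable if it admits an infinitesimal Moebius variation whose variational vector field is non-trivial on every non-empty open subset of $M$. A conformal infinitesimal bending of $f$ with conformal factor $\rho\in C^\infty(M)$ is a smooth vector field $\mathcal{T}$ along $f$ with $\langle\tilde\nabla_X\mathcal{T},f_*Y\rangle+\langle f_*X,\tilde\nabla_Y\mathcal{T}\rangle=2\rho\langle X,Y\rangle$ for all $X,Y$; it has the associated tensor $\beta(X,Y)=(\tilde\nabla_X\tilde\nabla_Y\mathcal{T}-\tilde\nabla_{\nabla_XY}\mathcal{T})_{N_fM}-\rho\,\alpha(X,Y)$ and the normal vector field $\mathcal{L}=\frac1n\sum_i\beta(X_i,X_i)$, for any orthonormal frame $X_1,\dots,X_n$. Then $f$ is infinitesimally Moebius bendable if and only if it admits a conformal infinitesimal bending, non-trivial on every non-empty open subset of $M$, whose conformal factor $\rho$ satisfies $$\Delta\rho+n\langle\mathcal{L},\mathcal{H}\rangle=0,$$ where $\mathcal{H}$ is the mean curvature vector of $f$ and $\Delta$ the Laplacian of $(M,g)$. Moreover, for every smooth variation of $f$ whose variational vector field is a conformal infinitesimal bending with conformal factor $\rho$, $$\frac{\partial}{\partial t}\Big|_{t=0}\phi_t^2=2n\Delta\rho-2\phi^2\rho+2n^2\langle\mathcal{L},\mathcal{H}\rangle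 .$$ -/

import Mathlib

open Set Manifold
open scoped ContDiff Matrix

noncomputable section

namespace MoebiusBending

/-- Euclidean space `ℝ^k` with its standard inner product. -/
abbrev Euc (k : ℕ) : Type := EuclideanSpace ℝ (Fin k)

/-- The standard basis vectors of `ℝ^k`. -/
def stdVec {k : ℕ} (i : Fin k) : Euc k := EuclideanSpace.single i (1 : ℝ)

/-- The Gram matrix of a bilinear form on `ℝ^n` in the standard basis. -/
def gram {n : ℕ} (b : Euc n →L[ℝ] Euc n →L[ℝ] ℝ) : Matrix (Fin n) (Fin n) ℝ :=
  Matrix.of fun i j => b (stdVec i) (stdVec j)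

/-- The trace of `B` with respect to the inner product `b`, that is `∑ bⁱʲ B(eᵢ, eⱼ)`. For bilinear
`B` it equals `∑ B(Xᵢ, Xᵢ)` for every `b`-orthonormal basis, see `metricTrace_eq_sum`. -/
def metricTrace {n : ℕ} {V : Type*} [AddCommGroup V] [Module ℝ V]
    (b : Euc n →L[ℝ] Euc n →L[ℝ] ℝ) (B : Euc n → Euc n → V) : V :=
  ∑ i, ∑ j, (gram b)⁻¹ i j • B (stdVec i) (stdVec j)

/-- The metric trace is the trace over any orthonormal basis. -/
theorem metricTrace_eq_sum {n : ℕ} {V : Type*} [AddCommGroup V] [Module ℝ V]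
    (b : Euc n →L[ℝ] Euc n →L[ℝ] ℝ) (B : Euc n →ₗ[ℝ] Euc n →ₗ[ℝ] V) (X : Fin n → Euc n)
    (hX : ∀ i j, b (X i) (X j) = if i = j then 1 else 0) :
    metricTrace b (fun v w => B v w) = ∑ i, B (X i) (X i) := by
  classical
  have hexp : ∀ v : Euc n, v = ∑ a, v a • (stdVec a : Euc n) := by
    intro v
    ext c
    simp [stdVec, Pi.single_apply]
  let P : Matrix (Fin n) (Fin n) ℝ := Matrix.of fun a i => X i a
  have h1 : Pᵀ * gram b * P = 1 := by
    ext i j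
    rw [Matrix.one_apply, ← hX i j]
    conv_rhs => rw [hexp (X i), hexp (X j)]
    simp only [Matrix.mul_apply, Matrix.transpose_apply, gram, Matrix.of_apply, P, map_sum,
      map_smul, _root_.sum_apply, _root_.smul_apply, smul_eq_mul,
      Finset.sum_mul, Finset.mul_sum]
    refine Finset.sum_congr rfl fun a _ => Finset.sum_congr rfl fun c _ => ?_
    ring
  have h2 : P * Pᵀ * gram b = 1 := by
    have h3 : P * (Pᵀ * gram b) = 1 := mul_eq_one_comm.mp h1
    rw [Matrix.mul_assoc]
    exact h3
  have h4 : (gram b)⁻¹ = P * Pᵀ := Matrix.inv_eq_left_inv h2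
  have h5 : ∀ i, B (X i) (X i) = ∑ a, ∑ c, (X i a * X i c) • B (stdVec a) (stdVec c) := by
    intro i
    conv_lhs => rw [hexp (X i)]
    simp only [map_sum, map_smul, LinearMap.sum_apply, LinearMap.smul_apply, Finset.smul_sum,
      smul_smul]
    rw [Finset.sum_comm]
    refine Finset.sum_congr rfl fun a _ => Finset.sum_congr rfl fun c _ => ?_
    rw [mul_comm]
  simp only [metricTrace, h4, h5, Matrix.mul_apply, Matrix.transpose_apply, P, Matrix.of_apply,
    Finset.sum_smul]
  rw [Finset.sum_comm' (t' := Finset.univ) (s' := fun _ => Finset.univ) (by simp)]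
  conv_lhs =>
    enter [2, j]
    rw [Finset.sum_comm]
  rw [Finset.sum_comm]
  refine Finset.sum_congr rfl fun i _ => ?_
  rw [Finset.sum_comm]

section Manifold

variable {n m : ℕ} {M : Type*} [TopologicalSpace M] [ChartedSpace (Euc n) M]

/-- A field of bilinear forms on the tangent spaces of `M`. The tangent space `T_x M` is by
definition a copy of `ℝ^n`, identified by the preferred chart at `x`. -/
abbrev BilinField (n : ℕ) (M : Type*) [TopologicalSpace M] [ChartedSpace (Euc n) M] : Type _ :=
  M → Euc n →L[ℝ] Euc n →L[ℝ] ℝ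

/-- The differential `h_*` at `x` of a map `h : M → V` into a normed space. -/
def diff {V : Type*} [NormedAddCommGroup V] [NormedSpace ℝ V] (h : M → V) (x : M) :
    Euc n →L[ℝ] V :=
  mfderiv (𝓡 n) 𝓘(ℝ, V) h x

/-- The metric `⟨h_* v, h_* w⟩` induced on `M` by `h : M → ℝ^m`. -/
def inducedMetric (h : M → Euc m) : BilinField n M :=
  fun x => (innerSL ℝ : Euc m →L[ℝ] Euc m →L[ℝ] ℝ).bilinearComp (diff h x) (diff h x)

/-- The differential at `u` of the inverse of the preferred chart at `x`. -/
def chartInvDiff (x : M) (u : Euc n) : Euc n →L[ℝ] Euc n :=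
  mfderiv 𝓘(ℝ, Euc n) (𝓡 n) (extChartAt (𝓡 n) x).symm u

/-- The metric `g` in the coordinates of the preferred chart at `x`. -/
def chartMetric (g : BilinField n M) (x : M) (u : Euc n) : Euc n →L[ℝ] Euc n →L[ℝ] ℝ :=
  (g ((extChartAt (𝓡 n) x).symm u)).bilinearComp (chartInvDiff x u) (chartInvDiff x u)

/-- The lowered Christoffel symbol `g(∇_v w, y)` at `x`, for the Levi-Civita connection of `g` and
the vector fields with constant components `v`, `w`, `y` in the preferred chart at `x`. -/
def christoffelLow (g : BilinField n M) (x : M) (v w y : Euc n) : ℝ :=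
  (fderiv ℝ (chartMetric g x) (extChartAt (𝓡 n) x x) v w y
    + fderiv ℝ (chartMetric g x) (extChartAt (𝓡 n) x x) w v y
    - fderiv ℝ (chartMetric g x) (extChartAt (𝓡 n) x x) y v w) / 2

/-- `∇_v w` at `x`, for the Levi-Civita connection of `g` and the vector fields with constant
components `v`, `w` in the preferred chart at `x`. -/
def christoffel (g : BilinField n M) (x : M) (v w : Euc n) : Euc n :=
  ∑ k, ∑ l, ((gram (chartMetric g x (extChartAt (𝓡 n) x x)))⁻¹ k l *
    christoffelLow g x v w (stdVec l)) • stdVec k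

/-- The Hessian `∇_X ∇_Y h - ∇_{∇_X Y} h` at `x` of a map `h` from `M` into a normed space, with
respect to the Levi-Civita connection of `g` and the flat connection of the target. The tangent
space at `x` is identified with `ℝ^n` by the preferred chart at `x`. -/
def hess {V : Type*} [NormedAddCommGroup V] [NormedSpace ℝ V] (g : BilinField n M) (h : M → V)
    (x : M) (v w : Euc n) : V :=
  fderiv ℝ (fderiv ℝ (h ∘ (extChartAt (𝓡 n) x).symm)) (extChartAt (𝓡 n) x x) v w
    - fderiv ℝ (h ∘ (extChartAt (𝓡 n) x).symm) (extChartAt (𝓡 n) x x) (christoffel g x v w)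

/-- The Laplacian `Δρ` of a function with respect to the metric `g`: the trace of its Hessian. -/
def laplacian (g : BilinField n M) (ρ : M → ℝ) (x : M) : ℝ :=
  metricTrace (g x) (hess g ρ x)

/-- The second fundamental form `α(X, Y) = ∇̃_X h_* Y - h_* ∇_X Y` of an immersion `h`, with `∇` the
Levi-Civita connection of the metric induced by `h` (the Gauss formula). -/
def secondFF (h : M → Euc m) (x : M) (v w : Euc n) : Euc m :=
  hess (inducedMetric h) h x v w

/-- The mean curvature vector `ℋ = (1/n) ∑ α(Xᵢ, Xᵢ)` of an immersion `h`. -/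
def meanCurv (h : M → Euc m) (x : M) : Euc m :=
  (n : ℝ)⁻¹ • metricTrace (inducedMetric h x) (secondFF (n := n) h x)

/-- `‖α‖² = ∑ ‖α(Xᵢ, Xⱼ)‖²`, the sum over an orthonormal basis of the metric induced by `h`. -/
def secondFFNormSq (h : M → Euc m) (x : M) : ℝ :=
  metricTrace (inducedMetric h x) fun v w : Euc n =>
    metricTrace (inducedMetric h x) fun v' w' : Euc n =>
      inner ℝ (secondFF h x v v') (secondFF h x w w')

/-- `φ² = n/(n-1) (‖α‖² - n ‖ℋ‖²)`, the conformal factor of the Moebius metric of `h`. -/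
def phiSq (h : M → Euc m) (x : M) : ℝ :=
  (n : ℝ) / ((n : ℝ) - 1) *
    (secondFFNormSq (n := n) h x - (n : ℝ) * ‖meanCurv (n := n) h x‖ ^ 2)

/-- `x` is an umbilical point of `h`: `α(v, w) = ⟨v, w⟩ ℋ` at `x`. -/
def IsUmbilic (h : M → Euc m) (x : M) : Prop :=
  ∀ v w : Euc n,
    secondFF h x v w = inducedMetric h x v w • meanCurv (n := n) h x

/-- `h` is a smooth isometric immersion of `(M, g)` into `ℝ^m`. -/
def IsIsometricImmersion (g : BilinField n M) (h : M → Euc m) : Prop :=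
  ContMDiff (𝓡 n) 𝓘(ℝ, Euc m) ∞ h ∧
    ∀ (x : M) (v w : Euc n), inducedMetric h x v w = g x v w

/-- `F` is a smooth variation of `f` by immersions `F t`, `t ∈ (-ε, ε)`. -/
structure IsVariation (f : M → Euc m) (ε : ℝ) (F : ℝ → M → Euc m) : Prop where
  pos : 0 < ε
  smooth : ContMDiffOn (𝓘(ℝ, ℝ).prod (𝓡 n)) 𝓘(ℝ, Euc m) ∞ (fun p : ℝ × M => F p.1 p.2)
    (Ioo (-ε) ε ×ˢ univ)
  zero : F 0 = f
  immersion : ∀ t ∈ Ioo (-ε) ε, ∀ x : M, Function.Injective (diff (n := n) (F t) x)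

/-- The variational vector field `𝒯 = F_* ∂/∂t |_{t=0}`. -/
def variationalField (F : ℝ → M → Euc m) (x : M) : Euc m :=
  deriv (fun t => F t x) 0

/-- `F` is an infinitesimal Moebius variation of `f`: the Moebius metrics `φ_t² ⟨f_t* X, f_t* Y⟩`
coincide up to first order at `t = 0`. -/
def IsInfinitesimalMoebiusVariation (f : M → Euc m) (ε : ℝ) (F : ℝ → M → Euc m) : Prop :=
  IsVariation (n := n) f ε F ∧
    ∀ (x : M) (v w : Euc n),
      HasDerivAt (fun t => phiSq (n := n) (F t) x * inducedMetric (F t) x v w) 0 0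

/-- `V` is a (smooth) conformal Killing vector field of `ℝ^m`. -/
def IsConformalKilling (V : Euc m → Euc m) : Prop :=
  ContDiff ℝ ∞ V ∧ ∃ σ : Euc m → ℝ, ∀ p v w : Euc m,
    inner ℝ (fderiv ℝ V p v) w + inner ℝ v (fderiv ℝ V p w) = 2 * σ p * inner ℝ v w

/-- The vector field `T` along `f` is trivial on `U`: there it is the restriction of a conformal
Killing vector field of `ℝ^m`. -/
def IsTrivialOn (f : M → Euc m) (T : M → Euc m) (U : Set M) : Prop :=
  ∃ V : Euc m → Euc m, IsConformalKilling V ∧ ∀ x ∈ U, T x = V (f x)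

/-- `T` is non-trivial restricted to any non-empty open subset of `M`. -/
def IsNowhereTrivial (f : M → Euc m) (T : M → Euc m) : Prop :=
  ∀ U : Set M, IsOpen U → U.Nonempty → ¬ IsTrivialOn f T U

/-- `f` is infinitesimally Moebius bendable: it admits an infinitesimal Moebius variation that is
non-trivial restricted to any non-empty open subset of `M`. -/
def IsInfinitesimallyMoebiusBendable (n : ℕ) {m : ℕ} {M : Type*} [TopologicalSpace M]
    [ChartedSpace (Euc n) M] (f : M → Euc m) : Prop :=
  ∃ (ε : ℝ) (F : ℝ → M → Euc m),
    IsInfinitesimalMoebiusVariation (n := n) f ε F ∧ IsNowhereTrivial f (variationalField F)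

/-- `T` is a conformal infinitesimal bending of `f : (M, g) → ℝ^m` with conformal factor `ρ`. -/
structure IsConformalInfinitesimalBending (g : BilinField n M) (f : M → Euc m)
    (T : M → Euc m) (ρ : M → ℝ) : Prop where
  smooth : ContMDiff (𝓡 n) 𝓘(ℝ, Euc m) ∞ T
  smooth_factor : ContMDiff (𝓡 n) 𝓘(ℝ, ℝ) ∞ ρ
  bending : ∀ (x : M) (v w : Euc n),
    inner ℝ (diff T x v) (diff f x w) + inner ℝ (diff f x v) (diff T x w) = 2 * ρ x * g x v w

/-- The normal space of `f` at `x`, the orthogonal complement of the image of the differential. -/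
def normalSpace (f : M → Euc m) (x : M) : Submodule ℝ (Euc m) :=
  ((diff (n := n) f x).toLinearMap.range)ᗮ

/-- The tensor `β(X, Y) = (∇̃_X ∇̃_Y 𝒯 - ∇̃_{∇_X Y} 𝒯)^⊥ - ρ α(X, Y)` associated with a conformal
infinitesimal bending `T` with conformal factor `ρ`. -/
def betaTensor (g : BilinField n M) (f T : M → Euc m) (ρ : M → ℝ) (x : M) (v w : Euc n) : Euc m :=
  (normalSpace (n := n) f x).starProjection (hess g T x v w) - ρ x • secondFF f x v w

/-- The normal vector field `ℒ = (1/n) ∑ β(Xᵢ, Xᵢ)`. -/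
def normalizedTraceBeta (g : BilinField n M) (f T : M → Euc m) (ρ : M → ℝ) (x : M) : Euc m :=
  (n : ℝ)⁻¹ • metricTrace (g x) (betaTensor g f T ρ x)

end Manifold

end MoebiusBending

end

/-! Everything rests on the formula for the derivative of `φ²`. If the variational field of a
variation is a conformal infinitesimal bending with factor `ρ`, the induced metrics satisfy `g' =
2ρg`. The product rule then turns the formula into `(φ²g)' = 2n(Δρ + n⟨ℒ,ℋ⟩)g`, so the variation is
infinitesimally Moebius exactly when the equation for `ρ` holds. Conversely, along an infinitesimal
Moebius variation `φ²g' = -(φ²)'g`. Since `φ²` vanishes only at umbilical points, division is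
allowed and the variational field is a conformal infinitesimal bending with `ρ = -(φ²)'/(2φ²)`.

To prove the formula (`hasDerivAt_jetPhiSq`), regard `φ²` at a point as a function of the first two
derivatives `A`, `B` of the immersion in a chart. Modulo tangent vectors, `α` varies by the
covariant Hessian `τ` of the variational field. Hence `(‖α‖²)' = 2S - 4ρ‖α‖²` with `S = ∑⟨τᵢⱼ,αᵢⱼ⟩`,
and `(‖ℋ‖²)' = (2/n)⟨tr τ,ℋ⟩ - 4ρ‖ℋ‖²`. The term `⟨tr τ,ℋ⟩` is expressed through `⟨ℒ,ℋ⟩`, but `S` is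
not. It is eliminated by the trace of the linearized Gauss equation (`linearized_gauss`), and this
is where `Δρ` enters. The Gauss equation itself comes from differentiating the bending equation
twice, in coordinates normal at the point, and combining the results so that all third derivatives
cancel.

For the direction from bendings to variations, `f + tT` need not consist of immersions when `M` is
not compact. `exists_variation` uses `f + s(t,δ)T` instead, with `s` tangent to `t` at `t = 0` and
bounded by a positive function `δ` on `M`. The function is chosen so small
(`exists_small_pos_function`) that the differential of `f` dominates the perturbation for every `t`.
The non-triviality condition concerns only the field and is carried along unchanged. -/

noncomputable section

namespace MoebiusBending

/-! ### Extrinsic geometry of an immersion from its 2-jet -/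

section Jets

variable {n m : ℕ}

theorem euc_expand (v : Euc n) : v = ∑ a, v a • (stdVec a : Euc n) := by
  ext c
  simp [stdVec, Pi.single_apply]

theorem gram_apply (b : Euc n →L[ℝ] Euc n →L[ℝ] ℝ) (i j : Fin n) :
    gram b i j = b (stdVec i) (stdVec j) := rfl

/-- The inner product induced by a linear map `A`. -/
def jetMetric (A : Euc n →L[ℝ] Euc m) : Euc n →L[ℝ] Euc n →L[ℝ] ℝ :=
  (innerSL ℝ : Euc m →L[ℝ] Euc m →L[ℝ] ℝ).bilinearComp A A

@[simp] theorem jetMetric_apply (A : Euc n →L[ℝ] Euc m) (v w : Euc n) :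
    jetMetric A v w = inner ℝ (A v) (A w) := rfl

/-- The left inverse of an injective linear map `A` that vanishes on the orthogonal complement of
its range. -/
def jetProj (A : Euc n →L[ℝ] Euc m) : Euc m →L[ℝ] Euc n :=
  ∑ k, ∑ l, (gram (jetMetric A))⁻¹ k l • (innerSL ℝ (A (stdVec l))).smulRight (stdVec k)

theorem jetProj_apply (A : Euc n →L[ℝ] Euc m) (p : Euc m) :
    jetProj A p = ∑ k, ∑ l, ((gram (jetMetric A))⁻¹ k l * inner ℝ (A (stdVec l)) p) • stdVec k := by
  simp [jetProj, _root_.sum_apply, smul_smul]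

/-- The second fundamental form of an immersion with first derivative `A` and second
derivative `B`. -/
def jetSff (A : Euc n →L[ℝ] Euc m) (B : Euc n →L[ℝ] Euc n →L[ℝ] Euc m) (v w : Euc n) : Euc m :=
  B v w - A (jetProj A (B v w))

/-- A null vector of the Gram matrix gives `w` with `A w` orthogonal to the range of `A`, hence to
itself; injectivity then forces `w = 0`. -/
theorem isUnit_det_gram {A : Euc n →L[ℝ] Euc m} (hA : Function.Injective A) :
    IsUnit (gram (jetMetric A)).det := by
  rw [isUnit_iff_ne_zero]
  intro h
  obtain ⟨v, hv, hv0⟩ := Matrix.exists_mulVec_eq_zero_iff.mpr h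
  apply hv
  set w : Euc n := WithLp.toLp 2 v with hw
  have hAw : A w = ∑ j, v j • A (stdVec j) := by
    conv_lhs => rw [euc_expand w]
    simp [hw]
  have h1 : inner ℝ (A w) (A w) = (0 : ℝ) := by
    have h2 : ∀ i, inner ℝ (A (stdVec i)) (A w) = (0 : ℝ) := by
      intro i
      have := congrFun hv0 i
      simp only [Matrix.mulVec, dotProduct, gram, Matrix.of_apply, jetMetric_apply,
        Pi.zero_apply] at this
      rw [hAw, inner_sum, ← this]
      exact Finset.sum_congr rfl fun j _ => by rw [inner_smul_right, mul_comm]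
    conv_lhs => rw [hAw, sum_inner]
    refine Finset.sum_eq_zero fun j _ => ?_
    rw [← hAw, inner_smul_left, h2, mul_zero]
  have h3 : A w = A 0 := by rw [inner_self_eq_zero.mp h1, map_zero]
  have h4 := hA h3
  funext i
  have := congrArg (fun z : Euc n => z i) h4
  simpa [hw] using this

/-- This says that `A ∘ jetProj A` is the orthogonal projection onto the range of `A`. It is enough
to test against the basis vectors, where the Gram matrix cancels its inverse. -/
theorem inner_map_jetProj {A : Euc n →L[ℝ] Euc m} (hA : Function.Injective A) (p : Euc m)
    (y : Euc n) : inner ℝ (A (jetProj A p)) (A y) = (inner ℝ p (A y) : ℝ) := by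
  have key : ∀ j, inner ℝ (A (stdVec j)) (A (jetProj A p)) = (inner ℝ (A (stdVec j)) p : ℝ) := by
    intro j
    rw [jetProj_apply]
    simp only [map_sum, map_smul, inner_sum, inner_smul_right]
    have h1 : gram (jetMetric A) * (gram (jetMetric A))⁻¹ = 1 :=
      Matrix.mul_nonsing_inv _ (isUnit_det_gram hA)
    rw [Finset.sum_comm]
    have h2 : ∀ l, ∑ k, (gram (jetMetric A))⁻¹ k l * inner ℝ (A (stdVec l)) p *
        inner ℝ (A (stdVec j)) (A (stdVec k)) = (if j = l then inner ℝ (A (stdVec l)) p else 0) := by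
      intro l
      have := congrFun (congrFun h1 j) l
      rw [Matrix.mul_apply, Matrix.one_apply] at this
      simp only [gram_apply, jetMetric_apply] at this
      calc _ = (∑ k, inner ℝ (A (stdVec j)) (A (stdVec k)) * (gram (jetMetric A))⁻¹ k l) *
            inner ℝ (A (stdVec l)) p := by
              rw [Finset.sum_mul]
              exact Finset.sum_congr rfl fun k _ => by ring
        _ = _ := by
          rw [this]; split_ifs <;> simp
    simp only [h2]
    simp
  rw [euc_expand y]
  simp only [map_sum, map_smul, inner_sum, inner_smul_right]
  refine Finset.sum_congr rfl fun j _ => ?_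
  rw [real_inner_comm, key, real_inner_comm]

theorem inner_jetSff {A : Euc n →L[ℝ] Euc m} (hA : Function.Injective A)
    (B : Euc n →L[ℝ] Euc n →L[ℝ] Euc m) (v w y : Euc n) :
    inner ℝ (jetSff A B v w) (A y) = (0 : ℝ) := by
  rw [jetSff, inner_sub_left, inner_map_jetProj hA, sub_self]

/-- The mean curvature vector in terms of the first two derivatives. -/
def jetMeanCurv (A : Euc n →L[ℝ] Euc m) (B : Euc n →L[ℝ] Euc n →L[ℝ] Euc m) : Euc m :=
  (n : ℝ)⁻¹ • metricTrace (jetMetric A) (jetSff A B)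

/-- The squared norm of the second fundamental form in terms of the first two derivatives. -/
def jetSffNormSq (A : Euc n →L[ℝ] Euc m) (B : Euc n →L[ℝ] Euc n →L[ℝ] Euc m) : ℝ :=
  metricTrace (jetMetric A) fun v w : Euc n =>
    metricTrace (jetMetric A) fun v' w' : Euc n =>
      inner ℝ (jetSff A B v v') (jetSff A B w w')

/-- The function `φ²` in terms of the first two derivatives. -/
def jetPhiSq (A : Euc n →L[ℝ] Euc m) (B : Euc n →L[ℝ] Euc n →L[ℝ] Euc m) : ℝ :=
  (n : ℝ) / ((n : ℝ) - 1) * (jetSffNormSq A B - (n : ℝ) * ‖jetMeanCurv A B‖ ^ 2)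

/-- An injective linear map induces an inner product with an orthonormal basis. -/
theorem exists_orthonormal_frame {A : Euc n →L[ℝ] Euc m} (hA : Function.Injective A) :
    ∃ X : Fin n → Euc n, (∀ i j, jetMetric A (X i) (X j) = if i = j then 1 else 0) ∧
      ∀ v, v = ∑ i, jetMetric A v (X i) • X i := by
  let e : Euc n ≃ₗ[ℝ] A.toLinearMap.range := LinearEquiv.ofInjective A.toLinearMap hA
  have hfr : Module.finrank ℝ A.toLinearMap.range = n := by
    rw [← e.finrank_eq]; simp
  let b := (stdOrthonormalBasis ℝ A.toLinearMap.range).reindex (finCongr hfr)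
  have hAe : ∀ z, A (e.symm z) = (z : Euc m) := fun z => by
    have := e.apply_symm_apply z
    exact congrArg Subtype.val this
  refine ⟨fun i => e.symm (b i), ?_, ?_⟩
  · intro i j
    have := orthonormal_iff_ite.mp b.orthonormal i j
    rw [jetMetric_apply, hAe, hAe]
    exact this
  · intro v
    apply e.injective
    rw [map_sum]
    simp only [map_smul, LinearEquiv.apply_symm_apply]
    conv_lhs => rw [← b.sum_repr' (e v)]
    refine Finset.sum_congr rfl fun i _ => ?_
    congr 1
    rw [jetMetric_apply, hAe, real_inner_comm]
    rfl

/-- The second fundamental form as a bilinear map. -/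
def jetSffLin (A : Euc n →L[ℝ] Euc m) (B : Euc n →L[ℝ] Euc n →L[ℝ] Euc m) :
    Euc n →ₗ[ℝ] Euc n →ₗ[ℝ] Euc m :=
  LinearMap.mk₂ ℝ (jetSff A B) (by intros; simp [jetSff]; abel) (by intros; simp [jetSff, smul_sub])
    (by intros; simp [jetSff]; abel) (by intros; simp [jetSff, smul_sub])

theorem metricTrace_eq_frame {V : Type*} [AddCommGroup V] [Module ℝ V]
    {b : Euc n →L[ℝ] Euc n →L[ℝ] ℝ} {C : Euc n → Euc n → V} (X : Fin n → Euc n)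
    (hX : ∀ i j, b (X i) (X j) = if i = j then 1 else 0)
    (h1 : ∀ u v w, C (u + v) w = C u w + C v w) (h2 : ∀ (c : ℝ) v w, C (c • v) w = c • C v w)
    (h3 : ∀ u v w, C u (v + w) = C u v + C u w) (h4 : ∀ (c : ℝ) v w, C v (c • w) = c • C v w) :
    metricTrace b C = ∑ i, C (X i) (X i) :=
  metricTrace_eq_sum b (LinearMap.mk₂ ℝ C h1 h2 h3 h4) X hX

/-- Two different forms are allowed because differentiating `‖α‖²` produces the mixed contraction of
`α` with the Hessian of the variational field. -/
theorem metricTrace_nested_eq_frame {b : Euc n →L[ℝ] Euc n →L[ℝ] ℝ} {P Q : Euc n → Euc n → Euc m}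
    (X : Fin n → Euc n)
    (hX : ∀ i j, b (X i) (X j) = if i = j then 1 else 0)
    (p1 : ∀ u v w, P (u + v) w = P u w + P v w) (p2 : ∀ (c : ℝ) v w, P (c • v) w = c • P v w)
    (p3 : ∀ u v w, P u (v + w) = P u v + P u w) (p4 : ∀ (c : ℝ) v w, P v (c • w) = c • P v w)
    (q1 : ∀ u v w, Q (u + v) w = Q u w + Q v w) (q2 : ∀ (c : ℝ) v w, Q (c • v) w = c • Q v w)
    (q3 : ∀ u v w, Q u (v + w) = Q u v + Q u w) (q4 : ∀ (c : ℝ) v w, Q v (c • w) = c • Q v w) :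
    metricTrace b (fun v w => metricTrace b fun v' w' => (inner ℝ (P v v') (Q w w') : ℝ)) =
      ∑ i, ∑ j, inner ℝ (P (X i) (X j)) (Q (X i) (X j)) := by
  have h : ∀ v w, metricTrace b (fun v' w' => (inner ℝ (P v v') (Q w w') : ℝ)) =
      ∑ j, inner ℝ (P v (X j)) (Q w (X j)) := by
    intro v w
    refine metricTrace_eq_frame X hX ?_ ?_ ?_ ?_ <;> intros <;>
      simp [p3, p4, q3, q4, inner_add_left, inner_add_right, inner_smul_left, inner_smul_right]
  simp only [h]
  refine metricTrace_eq_frame X hX ?_ ?_ ?_ ?_ <;> intros <;>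
    simp [p1, p2, q1, q2, inner_add_left, inner_add_right, inner_smul_left, inner_smul_right,
      Finset.sum_add_distrib, Finset.mul_sum]

theorem jetSff_add_left (A : Euc n →L[ℝ] Euc m) (B : Euc n →L[ℝ] Euc n →L[ℝ] Euc m)
    (u v w : Euc n) : jetSff A B (u + v) w = jetSff A B u w + jetSff A B v w :=
  LinearMap.map_add₂ (jetSffLin A B) u v w

theorem jetSff_smul_left (A : Euc n →L[ℝ] Euc m) (B : Euc n →L[ℝ] Euc n →L[ℝ] Euc m)
    (c : ℝ) (v w : Euc n) : jetSff A B (c • v) w = c • jetSff A B v w :=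
  LinearMap.map_smul₂ (jetSffLin A B) c v w

theorem jetSff_add_right (A : Euc n →L[ℝ] Euc m) (B : Euc n →L[ℝ] Euc n →L[ℝ] Euc m)
    (u v w : Euc n) : jetSff A B u (v + w) = jetSff A B u v + jetSff A B u w :=
  map_add (jetSffLin A B u) v w

theorem jetSff_smul_right (A : Euc n →L[ℝ] Euc m) (B : Euc n →L[ℝ] Euc n →L[ℝ] Euc m)
    (c : ℝ) (v w : Euc n) : jetSff A B v (c • w) = c • jetSff A B v w :=
  map_smul (jetSffLin A B v) c w

theorem metricTrace_jetSff_eq_frame {A : Euc n →L[ℝ] Euc m}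
    (B : Euc n →L[ℝ] Euc n →L[ℝ] Euc m) {b : Euc n →L[ℝ] Euc n →L[ℝ] ℝ} (X : Fin n → Euc n)
    (hX : ∀ i j, b (X i) (X j) = if i = j then 1 else 0) :
    metricTrace b (jetSff A B) = ∑ i, jetSff A B (X i) (X i) :=
  metricTrace_eq_frame X hX (jetSff_add_left A B) (jetSff_smul_left A B) (jetSff_add_right A B)
    (jetSff_smul_right A B)

theorem jetSffNormSq_eq_frame {A : Euc n →L[ℝ] Euc m}
    (B : Euc n →L[ℝ] Euc n →L[ℝ] Euc m) (X : Fin n → Euc n)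
    (hX : ∀ i j, jetMetric A (X i) (X j) = if i = j then 1 else 0) :
    jetSffNormSq A B = ∑ i, ∑ j, inner ℝ (jetSff A B (X i) (X j)) (jetSff A B (X i) (X j)) :=
  metricTrace_nested_eq_frame X hX (jetSff_add_left A B) (jetSff_smul_left A B)
    (jetSff_add_right A B) (jetSff_smul_right A B) (jetSff_add_left A B) (jetSff_smul_left A B)
    (jetSff_add_right A B) (jetSff_smul_right A B)

/-- `φ²` vanishes only at umbilical points. -/
theorem umbilic_of_jetPhiSq_eq_zero (hn : 2 ≤ n) {A : Euc n →L[ℝ] Euc m}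
    (hA : Function.Injective A) (B : Euc n →L[ℝ] Euc n →L[ℝ] Euc m) (h0 : jetPhiSq A B = 0)
    (v w : Euc n) : jetSff A B v w = jetMetric A v w • jetMeanCurv A B := by
  obtain ⟨X, hX, hexp⟩ := exists_orthonormal_frame hA
  have hn0 : (n : ℝ) ≠ 0 := by positivity
  have hn1 : (n : ℝ) - 1 ≠ 0 := by
    have : (2 : ℝ) ≤ n := by exact_mod_cast hn
    linarith
  have h1 : jetSffNormSq A B - (n : ℝ) * ‖jetMeanCurv A B‖ ^ 2 = 0 := by
    rcases mul_eq_zero.mp h0 with h | h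
    · exact absurd h (div_ne_zero hn0 hn1)
    · exact h
  set H := jetMeanCurv A B with hH
  have htr : ∑ i, jetSff A B (X i) (X i) = (n : ℝ) • H := by
    rw [hH, jetMeanCurv, metricTrace_jetSff_eq_frame B X hX, smul_smul, mul_inv_cancel₀ hn0,
      one_smul]
  -- `‖α‖² - n‖ℋ‖²` is the squared norm of the traceless part of `α`, so it vanishes only with that
  -- part.
  have h2 : ∑ i, ∑ j, ‖jetSff A B (X i) (X j) - (if i = j then (1 : ℝ) else 0) • H‖ ^ 2 = 0 := by
    have hsq : ∀ i j, ‖jetSff A B (X i) (X j) - (if i = j then (1 : ℝ) else 0) • H‖ ^ 2 =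
        inner ℝ (jetSff A B (X i) (X j)) (jetSff A B (X i) (X j)) -
        (if i = j then 2 * inner ℝ (jetSff A B (X i) (X i)) H - ‖H‖ ^ 2 else 0) := by
      intro i j
      rw [norm_sub_sq_real, real_inner_self_eq_norm_sq]
      split_ifs with h
      · subst h; simp; ring
      · simp
    simp only [hsq, Finset.sum_sub_distrib, Finset.sum_ite_eq, Finset.mem_univ, if_true]
    rw [← jetSffNormSq_eq_frame B X hX, ← Finset.mul_sum, ← sum_inner, htr, inner_smul_left]
    simp only [Finset.sum_const, Finset.card_univ, Fintype.card_fin, nsmul_eq_mul,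
      real_inner_self_eq_norm_sq]
    simp only [conj_trivial]
    linarith
  have h3 : ∀ i j, jetSff A B (X i) (X j) = (if i = j then (1 : ℝ) else 0) • H := by
    intro i j
    have h4 := (Finset.sum_eq_zero_iff_of_nonneg
      (fun i _ => Finset.sum_nonneg fun j _ => by positivity)).mp h2 i (Finset.mem_univ i)
    have h5 := (Finset.sum_eq_zero_iff_of_nonneg
      (fun j _ => by positivity)).mp h4 j (Finset.mem_univ j)
    exact sub_eq_zero.mp (norm_eq_zero.mp (pow_eq_zero_iff (two_ne_zero) |>.mp h5))
  have hlin : ∀ v w, jetSff A B v w = jetSffLin A B v w := fun _ _ => rfl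
  conv_lhs => rw [hexp v, hexp w]
  conv_rhs => rw [hexp v, hexp w]
  rw [hlin]
  simp only [map_sum, map_smul, LinearMap.sum_apply, LinearMap.smul_apply, ← hlin, h3,
    _root_.sum_apply, _root_.smul_apply, hX, Finset.sum_smul, smul_smul, smul_eq_mul,
    Finset.smul_sum, Finset.mul_sum]

end Jets

/-! ### Differentiation of 2-jet quantities in the parameter -/

section JetDerivatives

variable {n m : ℕ}

theorem differentiableAt_matrix_det {ι : Type*} [Fintype ι] [DecidableEq ι] {G : ℝ → Matrix ι ι ℝ}
    {s : ℝ} (hG : ∀ i j, DifferentiableAt ℝ (fun t => G t i j) s) :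
    DifferentiableAt ℝ (fun t => (G t).det) s := by
  simp only [Matrix.det_apply]
  refine DifferentiableAt.fun_sum fun σ _ => ?_
  refine DifferentiableAt.fun_const_smul (R := ℤˣ) ?_ (Equiv.Perm.sign σ)
  exact DifferentiableAt.fun_finsetProd fun i _ => hG _ _

/-- By Cramer's rule the entries of the inverse are rational in those of the matrix. -/
theorem differentiableAt_matrix_inv {ι : Type*} [Fintype ι] [DecidableEq ι] {G : ℝ → Matrix ι ι ℝ}
    {s : ℝ} (hG : ∀ i j, DifferentiableAt ℝ (fun t => G t i j) s) (hs : IsUnit (G s).det)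
    (i j : ι) : DifferentiableAt ℝ (fun t => (G t)⁻¹ i j) s := by
  simp only [Matrix.inv_def, Matrix.smul_apply, Ring.inverse_eq_inv', smul_eq_mul,
    Matrix.adjugate_apply]
  refine DifferentiableAt.fun_mul ((differentiableAt_matrix_det hG).inv hs.ne_zero) ?_
  refine differentiableAt_matrix_det fun k l => ?_
  simp only [Matrix.updateRow_apply]
  split_ifs
  · exact differentiableAt_const _
  · exact hG k l

/-- Only the conformal case `G' = cG` is needed. Differentiating `G⁻¹G = 1` gives `((G⁻¹)' + cG⁻¹)G
= 0`. -/
theorem hasDerivAt_matrix_inv {ι : Type*} [Fintype ι] [DecidableEq ι] {G : ℝ → Matrix ι ι ℝ}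
    {s c : ℝ} (hG : ∀ i j, HasDerivAt (fun t => G t i j) (c * G s i j) s) (hs : IsUnit (G s).det)
    (i j : ι) : HasDerivAt (fun t => (G t)⁻¹ i j) (-(c * (G s)⁻¹ i j)) s := by
  have hd : ∀ i j, DifferentiableAt ℝ (fun t => G t i j) s := fun i j => (hG i j).differentiableAt
  have hN : ∀ i j, HasDerivAt (fun t => (G t)⁻¹ i j) (deriv (fun t => (G t)⁻¹ i j) s) s :=
    fun i j => (differentiableAt_matrix_inv hd hs i j).hasDerivAt
  set N' : Matrix ι ι ℝ := Matrix.of fun i j => deriv (fun t => (G t)⁻¹ i j) s with hN'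
  have hev : ∀ᶠ t in nhds s, IsUnit (G t).det := by
    filter_upwards [(differentiableAt_matrix_det hd).continuousAt.eventually_ne hs.ne_zero]
      with t ht using isUnit_iff_ne_zero.mpr ht
  have h0 : (N' + c • (G s)⁻¹) * G s = 0 := by
    ext a b
    have h1 : HasDerivAt (fun t => ∑ k, (G t)⁻¹ a k * G t k b)
        (∑ k, (N' a k * G s k b + (G s)⁻¹ a k * (c * G s k b))) s :=
      HasDerivAt.fun_sum fun k _ => (hN a k).mul (hG k b)
    have h2 : (fun t => ∑ k, (G t)⁻¹ a k * G t k b) =ᶠ[nhds s]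
        fun _ => (1 : Matrix ι ι ℝ) a b := by
      filter_upwards [hev] with t ht
      rw [← Matrix.mul_apply, Matrix.nonsing_inv_mul _ ht]
    have h3 := (h1.congr_of_eventuallyEq h2.symm).unique (hasDerivAt_const s _)
    rw [Matrix.mul_apply, Matrix.zero_apply, ← h3]
    refine Finset.sum_congr rfl fun k _ => ?_
    simp only [Matrix.add_apply, Matrix.smul_apply, smul_eq_mul]
    ring
  have h4 : N' + c • (G s)⁻¹ = 0 := by
    have := congrArg (· * (G s)⁻¹) h0
    simpa [Matrix.mul_assoc, Matrix.mul_nonsing_inv _ hs] using this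
  have h5 := congrFun (congrFun h4 i) j
  have h6 : deriv (fun t => (G t)⁻¹ i j) s = -(c * (G s)⁻¹ i j) := by
    simp only [Matrix.add_apply, Matrix.smul_apply, smul_eq_mul, hN', Matrix.of_apply,
      Matrix.zero_apply] at h5
    linarith
  rw [← h6]
  exact hN i j

theorem differentiableAt_metricTrace {V : Type*} [NormedAddCommGroup V] [NormedSpace ℝ V]
    {b : ℝ → Euc n →L[ℝ] Euc n →L[ℝ] ℝ} {C : ℝ → Euc n → Euc n → V} {s : ℝ}
    (hb : ∀ v w, DifferentiableAt ℝ (fun t => b t v w) s) (hs : IsUnit (gram (b s)).det)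
    (hC : ∀ v w, DifferentiableAt ℝ (fun t => C t v w) s) :
    DifferentiableAt ℝ (fun t => metricTrace (b t) (C t)) s := by
  unfold metricTrace
  exact DifferentiableAt.fun_sum fun i _ => DifferentiableAt.fun_sum fun j _ =>
    (differentiableAt_matrix_inv (G := fun t => gram (b t)) (fun k l => hb _ _) hs i j).fun_smul
      (hC _ _)

/-- Each contraction with the inverse of a conformally varying metric costs one term `-c` times the
trace; `‖α‖²`, being contracted twice, picks up two. -/
theorem hasDerivAt_metricTrace {V : Type*} [NormedAddCommGroup V] [NormedSpace ℝ V]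
    {b : ℝ → Euc n →L[ℝ] Euc n →L[ℝ] ℝ} {C : ℝ → Euc n → Euc n → V} {C' : Euc n → Euc n → V}
    {s c : ℝ} (hb : ∀ v w, HasDerivAt (fun t => b t v w) (c * b s v w) s)
    (hs : IsUnit (gram (b s)).det) (hC : ∀ v w, HasDerivAt (fun t => C t v w) (C' v w) s) :
    HasDerivAt (fun t => metricTrace (b t) (C t))
      (metricTrace (b s) C' - c • metricTrace (b s) (C s)) s := by
  unfold metricTrace
  have h : ∀ i j, HasDerivAt (fun t => (gram (b t))⁻¹ i j • C t (stdVec i) (stdVec j))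
      ((gram (b s))⁻¹ i j • C' (stdVec i) (stdVec j) +
        (-(c * (gram (b s))⁻¹ i j)) • C s (stdVec i) (stdVec j)) s := fun i j =>
    (hasDerivAt_matrix_inv (G := fun t => gram (b t)) (fun k l => hb _ _) hs i j).fun_smul
      (hC _ _)
  refine (HasDerivAt.fun_sum fun i _ => HasDerivAt.fun_sum fun j _ => h i j).congr_deriv ?_
  simp only [Finset.smul_sum, ← Finset.sum_sub_distrib]
  refine Finset.sum_congr rfl fun i _ => Finset.sum_congr rfl fun j _ => ?_
  rw [neg_smul, smul_smul, sub_eq_add_neg]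

variable {A : ℝ → Euc n →L[ℝ] Euc m} {B : ℝ → Euc n →L[ℝ] Euc n →L[ℝ] Euc m}
  {A' : Euc n →L[ℝ] Euc m} {B' : Euc n →L[ℝ] Euc n →L[ℝ] Euc m}

theorem hasDerivAt_jetMetric (hA : HasDerivAt A A' 0) (v w : Euc n) :
    HasDerivAt (fun t => jetMetric (A t) v w)
      (inner ℝ (A' v) (A 0 w) + inner ℝ (A 0 v) (A' w)) 0 := by
  simp only [jetMetric_apply]
  refine ((hA.clm_apply (hasDerivAt_const 0 v)).inner ℝ
    (hA.clm_apply (hasDerivAt_const 0 w))).congr_deriv ?_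
  simp
  ring

/-- The second fundamental form varies, up to a tangent vector, by the covariant Hessian of the
variational field. -/
theorem hasDerivAt_jetSff (hA : HasDerivAt A A' 0) (hB : HasDerivAt B B' 0)
    (h0 : Function.Injective (A 0)) (v w : Euc n) :
    ∃ z, HasDerivAt (fun t => jetSff (A t) (B t) v w)
      (B' v w - A' (jetProj (A 0) (B 0 v w)) - A 0 z) 0 := by
  have hBvw : HasDerivAt (fun t => B t v w) (B' v w) 0 := by
    simpa using (hB.clm_apply (hasDerivAt_const 0 v)).clm_apply (hasDerivAt_const 0 w)
  have hP : DifferentiableAt ℝ (fun t => jetProj (A t) (B t v w)) 0 := by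
    simp only [jetProj_apply]
    refine DifferentiableAt.fun_sum fun i _ => DifferentiableAt.fun_sum fun j _ => ?_
    refine DifferentiableAt.smul_const (DifferentiableAt.fun_mul ?_ ?_) _
    · exact differentiableAt_matrix_inv (G := fun t => gram (jetMetric (A t)))
        (fun k l => (hasDerivAt_jetMetric hA _ _).differentiableAt) (isUnit_det_gram h0) i j
    · exact (hA.clm_apply (hasDerivAt_const 0 _)).differentiableAt.inner ℝ hBvw.differentiableAt
  -- The derivative of the tangential coefficients enters only through `A 0`, so its value is
  -- irrelevant: it will be paired with normal vectors.
  refine ⟨deriv (fun t => jetProj (A t) (B t v w)) 0, ?_⟩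
  refine (hBvw.sub (hA.clm_apply hP.hasDerivAt)).congr_deriv ?_
  abel

theorem differentiableAt_jetPhiSq (hA : HasDerivAt A A' 0) (hB : HasDerivAt B B' 0)
    (h0 : Function.Injective (A 0)) : DifferentiableAt ℝ (fun t => jetPhiSq (A t) (B t)) 0 := by
  have hb : ∀ v w, DifferentiableAt ℝ (fun t => jetMetric (A t) v w) 0 := fun v w =>
    (hasDerivAt_jetMetric hA v w).differentiableAt
  have hs : ∀ v w, DifferentiableAt ℝ (fun t => jetSff (A t) (B t) v w) 0 := fun v w =>
    (hasDerivAt_jetSff hA hB h0 v w).choose_spec.differentiableAt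
  have hu := isUnit_det_gram h0
  have h1 : DifferentiableAt ℝ (fun t => jetSffNormSq (A t) (B t)) 0 := by
    unfold jetSffNormSq
    exact differentiableAt_metricTrace hb hu fun v w => differentiableAt_metricTrace hb hu
      fun v' w' => (hs v v').inner ℝ (hs w w')
  have h2 : DifferentiableAt ℝ (fun t => jetMeanCurv (A t) (B t)) 0 := by
    unfold jetMeanCurv
    exact (differentiableAt_metricTrace hb hu hs).fun_const_smul (n : ℝ)⁻¹
  exact (h1.fun_sub ((h2.norm_sq ℝ).const_mul (n : ℝ))).const_mul _

end JetDerivatives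

/-! ### The first variation of `φ²` -/

section PhiDerivative

variable {n m : ℕ}

theorem metricTrace_add {V : Type*} [AddCommGroup V] [Module ℝ V]
    (b : Euc n →L[ℝ] Euc n →L[ℝ] ℝ) (C D : Euc n → Euc n → V) :
    metricTrace b (fun v w => C v w + D v w) = metricTrace b C + metricTrace b D := by
  simp only [metricTrace, smul_add, Finset.sum_add_distrib]

theorem metricTrace_smul {V : Type*} [AddCommGroup V] [Module ℝ V]
    (b : Euc n →L[ℝ] Euc n →L[ℝ] ℝ) (c : ℝ) (C : Euc n → Euc n → V) :
    metricTrace b (fun v w => c • C v w) = c • metricTrace b C := by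
  simp only [metricTrace, Finset.smul_sum]
  exact Finset.sum_congr rfl fun i _ => Finset.sum_congr rfl fun j _ => smul_comm _ _ _

theorem metricTrace_sub {V : Type*} [AddCommGroup V] [Module ℝ V]
    (b : Euc n →L[ℝ] Euc n →L[ℝ] ℝ) (C D : Euc n → Euc n → V) :
    metricTrace b (fun v w => C v w - D v w) = metricTrace b C - metricTrace b D := by
  simp only [metricTrace, smul_sub, Finset.sum_sub_distrib]

theorem inner_metricTrace (b : Euc n →L[ℝ] Euc n →L[ℝ] ℝ) (C : Euc n → Euc n → Euc m)
    (p : Euc m) :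
    (inner ℝ (metricTrace b C) p : ℝ) = metricTrace b (fun v w => (inner ℝ (C v w) p : ℝ)) := by
  simp only [metricTrace, sum_inner, inner_smul_left, conj_trivial, smul_eq_mul]

variable {A : ℝ → Euc n →L[ℝ] Euc m} {B : ℝ → Euc n →L[ℝ] Euc n →L[ℝ] Euc m}
  {A' : Euc n →L[ℝ] Euc m} {B' : Euc n →L[ℝ] Euc n →L[ℝ] Euc m}

theorem inner_jetMeanCurv {A : Euc n →L[ℝ] Euc m} (hA : Function.Injective A)
    (B : Euc n →L[ℝ] Euc n →L[ℝ] Euc m) (y : Euc n) :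
    inner ℝ (A y) (jetMeanCurv A B) = (0 : ℝ) := by
  rw [real_inner_comm, jetMeanCurv, inner_smul_left, inner_metricTrace]
  simp [inner_jetSff hA, metricTrace]

/-- The covariant Hessian of a field with first derivative `A'` and second derivative `B'` along an
immersion with first derivative `A` and second derivative `B`. -/
def jetHess {V : Type*} [NormedAddCommGroup V] [NormedSpace ℝ V] (A : Euc n →L[ℝ] Euc m)
    (B : Euc n →L[ℝ] Euc n →L[ℝ] Euc m) (A' : Euc n →L[ℝ] V) (B' : Euc n →L[ℝ] Euc n →L[ℝ] V)
    (v w : Euc n) : V :=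
  B' v w - A' (jetProj A (B v w))

/-- The part of the linearized Gauss equation that is bilinear in the second derivatives. -/
def gaussPairing (α τ : Euc n → Euc n → Euc m) (r : ℝ) (x y z w : Euc n) : ℝ :=
  inner ℝ (τ x y) (α z w) + inner ℝ (α x y) (τ z w) - 2 * r * inner ℝ (α x y) (α z w)

theorem inner_starProjection_jetSff {A : Euc n →L[ℝ] Euc m} (hA : Function.Injective A)
    (B : Euc n →L[ℝ] Euc n →L[ℝ] Euc m) (p : Euc m) (v w : Euc n) :
    (inner ℝ ((A.toLinearMap.range)ᗮ.starProjection p) (jetSff A B v w) : ℝ) =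
      inner ℝ p (jetSff A B v w) := by
  have hmem : jetSff A B v w ∈ (A.toLinearMap.range)ᗮ := by
    rw [Submodule.mem_orthogonal]
    rintro _ ⟨y, rfl⟩
    rw [real_inner_comm]
    exact inner_jetSff hA B v w y
  rw [Submodule.inner_starProjection_left_eq_right, Submodule.starProjection_eq_self_iff.mpr hmem]

/-- The variation of `φ²` under a variation that is conformal to first order, given the linearized
Gauss equation. -/
theorem hasDerivAt_jetPhiSq (hn : 2 ≤ n) (hA : HasDerivAt A A' 0) (hB : HasDerivAt B B' 0)
    (h0 : Function.Injective (A 0)) {r : ℝ}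
    (hbend : ∀ v w, inner ℝ (A' v) (A 0 w) + inner ℝ (A 0 v) (A' w) =
      2 * r * jetMetric (A 0) v w)
    {R' : Euc n →L[ℝ] ℝ} {R'' : Euc n →L[ℝ] Euc n →L[ℝ] ℝ}
    (hgauss : ∀ v w,
      gaussPairing (jetSff (A 0) (B 0)) (jetHess (A 0) (B 0) A' B') r v w v w -
        gaussPairing (jetSff (A 0) (B 0)) (jetHess (A 0) (B 0) A' B') r v v w w =
      jetHess (A 0) (B 0) R' R'' v v * jetMetric (A 0) w w +
        jetHess (A 0) (B 0) R' R'' w w * jetMetric (A 0) v v -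
        2 * (jetHess (A 0) (B 0) R' R'' v w * jetMetric (A 0) v w)) :
    HasDerivAt (fun t => jetPhiSq (A t) (B t))
      (2 * n * metricTrace (jetMetric (A 0)) (jetHess (A 0) (B 0) R' R'')
        - 2 * jetPhiSq (A 0) (B 0) * r +
        2 * n ^ 2 * inner ℝ ((n : ℝ)⁻¹ • metricTrace (jetMetric (A 0)) fun v w =>
          ((A 0).toLinearMap.range)ᗮ.starProjection (jetHess (A 0) (B 0) A' B' v w) -
            r • jetSff (A 0) (B 0) v w) (jetMeanCurv (A 0) (B 0))) 0 := by
  obtain ⟨X, hX, -⟩ := exists_orthonormal_frame h0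
  have hn0 : (n : ℝ) ≠ 0 := by positivity
  have hn1 : (n : ℝ) - 1 ≠ 0 := by
    have : (2 : ℝ) ≤ n := by exact_mod_cast hn
    linarith
  set b := jetMetric (A 0) with hb
  set α := jetSff (A 0) (B 0) with hα
  set τ := jetHess (A 0) (B 0) A' B' with hτ
  set h := jetHess (A 0) (B 0) R' R'' with hh
  set H := jetMeanCurv (A 0) (B 0) with hH
  have hbd : ∀ v w, HasDerivAt (fun t => jetMetric (A t) v w) (2 * r * jetMetric (A 0) v w) 0 :=
    fun v w => (hasDerivAt_jetMetric hA v w).congr_deriv (hbend v w)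
  have hu := isUnit_det_gram h0
  choose z hz using hasDerivAt_jetSff hA hB h0
  have hz' : ∀ v w, HasDerivAt (fun t => jetSff (A t) (B t) v w) (τ v w - A 0 (z v w)) 0 := hz
  have hperp : ∀ v w y, inner ℝ (α v w) (A 0 y) = (0 : ℝ) := inner_jetSff h0 _
  have hperp' : ∀ v w y, inner ℝ (A 0 y) (α v w) = (0 : ℝ) := fun v w y => by
    rw [real_inner_comm, hperp]
  have τ1 : ∀ u v w, τ (u + v) w = τ u w + τ v w := by intros; simp [hτ, jetHess]; abel
  have τ2 : ∀ (c : ℝ) v w, τ (c • v) w = c • τ v w := by intros; simp [hτ, jetHess, smul_sub]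
  have τ3 : ∀ u v w, τ u (v + w) = τ u v + τ u w := by intros; simp [hτ, jetHess]; abel
  have τ4 : ∀ (c : ℝ) v w, τ v (c • w) = c • τ v w := by intros; simp [hτ, jetHess, smul_sub]
  have h1 : ∀ u v w, h (u + v) w = h u w + h v w := by intros; simp [hh, jetHess]; ring
  have h2 : ∀ (c : ℝ) v w, h (c • v) w = c • h v w := by intros; simp [hh, jetHess]; ring
  have h3 : ∀ u v w, h u (v + w) = h u v + h u w := by intros; simp [hh, jetHess]; ring
  have h4 : ∀ (c : ℝ) v w, h v (c • w) = c • h v w := by intros; simp [hh, jetHess]; ring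
  set N := jetSffNormSq (A 0) (B 0) with hN
  set S := ∑ i, ∑ j, (inner ℝ (τ (X i) (X j)) (α (X i) (X j)) : ℝ) with hS
  set D := (inner ℝ (metricTrace b τ) H : ℝ) with hD
  have hτα : metricTrace b (fun v w => metricTrace b fun v' w' =>
      (inner ℝ (τ v v') (α w w') : ℝ)) = S :=
    metricTrace_nested_eq_frame X hX τ1 τ2 τ3 τ4 (jetSff_add_left _ _) (jetSff_smul_left _ _)
      (jetSff_add_right _ _) (jetSff_smul_right _ _)
  have hατ : metricTrace b (fun v w => metricTrace b fun v' w' =>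
      (inner ℝ (α v v') (τ w w') : ℝ)) = S := by
    rw [metricTrace_nested_eq_frame X hX (jetSff_add_left _ _) (jetSff_smul_left _ _)
      (jetSff_add_right _ _) (jetSff_smul_right _ _) τ1 τ2 τ3 τ4]
    exact Finset.sum_congr rfl fun i _ => Finset.sum_congr rfl fun j _ => real_inner_comm _ _
  -- The tangential terms `A 0 (z v w)` are orthogonal to `α` and disappear; the two contractions
  -- contribute `-2rN` each.
  have hNd : HasDerivAt (fun t => jetSffNormSq (A t) (B t)) (2 * S - 4 * r * N) 0 := by
    have hin : ∀ v w v' w', HasDerivAt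
        (fun t => (inner ℝ (jetSff (A t) (B t) v v') (jetSff (A t) (B t) w w') : ℝ))
        (inner ℝ (τ v v') (α w w') + inner ℝ (α v v') (τ w w')) 0 := by
      intro v w v' w'
      refine ((hz' v v').inner ℝ (hz' w w')).congr_deriv ?_
      change inner ℝ (α v v') _ + inner ℝ _ (α w w') = _
      rw [inner_sub_left, inner_sub_right, hperp, hperp']
      ring
    have := hasDerivAt_metricTrace hbd hu fun v w =>
      hasDerivAt_metricTrace hbd hu fun v' w' => hin v w v' w'
    refine this.congr_deriv ?_
    rw [metricTrace_sub]
    simp only [metricTrace_add, metricTrace_smul]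
    rw [hτα, hατ]
    change S + S - (2 * r) • N - (2 * r) • N = _
    simp only [smul_eq_mul]
    ring
  have htrα : metricTrace b α = (n : ℝ) • H := by
    rw [hH, jetMeanCurv, smul_smul, mul_inv_cancel₀ hn0, one_smul]
  have hHd : HasDerivAt (fun t => ‖jetMeanCurv (A t) (B t)‖ ^ 2)
      (2 * (n : ℝ)⁻¹ * D - 4 * r * ‖H‖ ^ 2) 0 := by
    have h5 : HasDerivAt (fun t => jetMeanCurv (A t) (B t)) ((n : ℝ)⁻¹ •
        (metricTrace b (fun v w => τ v w - A 0 (z v w)) - (2 * r) • metricTrace b α)) 0 :=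
      (hasDerivAt_metricTrace hbd hu hz').const_smul (n : ℝ)⁻¹
    refine h5.norm_sq.congr_deriv ?_
    change 2 * inner ℝ H _ = _
    rw [real_inner_comm, htrα, inner_smul_left, inner_sub_left, inner_smul_left, inner_smul_left,
      metricTrace_sub, inner_sub_left, ← hD, inner_metricTrace b (fun v w => A 0 (z v w))]
    have h6 : metricTrace b (fun v w => (inner ℝ (A 0 (z v w)) H : ℝ)) = 0 := by
      simp only [hH, inner_jetMeanCurv h0]
      simp [metricTrace]
    rw [h6, real_inner_self_eq_norm_sq]
    simp only [conj_trivial]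
    field_simp
    ring
  have hL : (inner ℝ ((n : ℝ)⁻¹ • metricTrace b fun v w =>
      ((A 0).toLinearMap.range)ᗮ.starProjection (τ v w) - r • α v w) H : ℝ) =
      (n : ℝ)⁻¹ * D - r * ‖H‖ ^ 2 := by
    -- The vector `H` is a trace of normal vectors, so pairing with it does not see the normal
    -- projection in `β`.
    have h7 : ∀ p, (inner ℝ (((A 0).toLinearMap.range)ᗮ.starProjection p) H : ℝ) = inner ℝ p H := by
      intro p
      rw [real_inner_comm, real_inner_comm H p, hH, jetMeanCurv, inner_smul_left, inner_smul_left,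
        inner_metricTrace, inner_metricTrace]
      congr 2
      funext v w
      rw [real_inner_comm, inner_starProjection_jetSff h0, real_inner_comm]
    rw [inner_smul_left, metricTrace_sub, inner_sub_left, metricTrace_smul, htrα,
      inner_metricTrace b (fun v w => ((A 0).toLinearMap.range)ᗮ.starProjection (τ v w))]
    simp only [h7]
    rw [← inner_metricTrace, ← hD, inner_smul_left, inner_smul_left, real_inner_self_eq_norm_sq]
    simp only [conj_trivial]
    field_simp
  -- The linearized Gauss equation summed over all pairs of an orthonormal frame; this is what
  -- expresses `S` through `D` and the Laplacian. The factor `n - 1` later cancels the denominator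
  -- in `φ²`.
  have hG : 2 * S - 2 * r * N - 2 * n * D + 2 * r * n ^ 2 * ‖H‖ ^ 2 =
      2 * (n - 1) * metricTrace b h := by
    have htrh : metricTrace b h = ∑ i, h (X i) (X i) := metricTrace_eq_frame X hX h1 h2 h3 h4
    have htrτ : metricTrace b τ = ∑ i, τ (X i) (X i) := metricTrace_eq_frame X hX τ1 τ2 τ3 τ4
    have htrα' : ∑ i, α (X i) (X i) = (n : ℝ) • H := by
      rw [← htrα]; exact (metricTrace_jetSff_eq_frame _ X hX).symm
    have hNf : N = ∑ i, ∑ j, (inner ℝ (α (X i) (X j)) (α (X i) (X j)) : ℝ) :=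
      jetSffNormSq_eq_frame _ X hX
    have hsum : ∑ i, ∑ j, (gaussPairing α τ r (X i) (X j) (X i) (X j) -
        gaussPairing α τ r (X i) (X i) (X j) (X j)) = ∑ i, ∑ j,
        (h (X i) (X i) * b (X j) (X j) + h (X j) (X j) * b (X i) (X i) -
          2 * (h (X i) (X j) * b (X i) (X j))) :=
      Finset.sum_congr rfl fun i _ => Finset.sum_congr rfl fun j _ => hgauss _ _
    have e1 : ∑ i, ∑ j, gaussPairing α τ r (X i) (X j) (X i) (X j) = 2 * S - 2 * r * N := by
      rw [hS, hNf, Finset.mul_sum, Finset.mul_sum, ← Finset.sum_sub_distrib]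
      refine Finset.sum_congr rfl fun i _ => ?_
      rw [Finset.mul_sum, Finset.mul_sum, ← Finset.sum_sub_distrib]
      refine Finset.sum_congr rfl fun j _ => ?_
      rw [gaussPairing, real_inner_comm (τ (X i) (X j)) (α (X i) (X j))]
      ring
    have e2 : ∑ i, ∑ j, gaussPairing α τ r (X i) (X i) (X j) (X j) =
        2 * n * D - 2 * r * n ^ 2 * ‖H‖ ^ 2 := by
      simp only [gaussPairing, Finset.sum_sub_distrib, Finset.sum_add_distrib, ← inner_sum,
        ← Finset.mul_sum, ← sum_inner, htrα', ← htrτ]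
      rw [inner_smul_right, inner_smul_left, inner_smul_left, inner_smul_right,
        real_inner_comm (metricTrace b τ) H, real_inner_self_eq_norm_sq]
      simp only [conj_trivial, ← hD]
      ring
    have e3 : ∑ i, ∑ j, (h (X i) (X i) * b (X j) (X j) + h (X j) (X j) * b (X i) (X i) -
        2 * (h (X i) (X j) * b (X i) (X j))) = 2 * (n - 1) * metricTrace b h := by
      rw [htrh]
      simp only [hX, if_true, mul_one, mul_ite, mul_zero, Finset.sum_sub_distrib,
        Finset.sum_add_distrib, Finset.sum_ite_eq, Finset.mem_univ, Finset.sum_const,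
        Finset.card_univ, Fintype.card_fin, nsmul_eq_mul, ← Finset.mul_sum]
      ring
    simp only [Finset.sum_sub_distrib] at hsum e3
    rw [e1, e2, e3] at hsum
    linarith
  refine ((hNd.sub (hHd.const_mul (n : ℝ))).const_mul ((n : ℝ) / ((n : ℝ) - 1))).congr_deriv ?_
  rw [hL, jetPhiSq, ← hN, ← hH]
  field_simp
  linear_combination hG

end PhiDerivative

/-! ### The linearized Gauss equation in normal coordinates -/

section LinearizedGauss

open Filter Topology

variable {E V : Type*} [NormedAddCommGroup E] [NormedSpace ℝ E]
  [NormedAddCommGroup V] [NormedSpace ℝ V]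

/-- The derivative of `P` in the constant direction `a`. -/
def dirDeriv (a : E) (P : E → V) (u : E) : V := fderiv ℝ P u a

theorem contDiffAt_fderiv {P : E → V} {u : E} (hP : ContDiffAt ℝ ∞ P u) :
    ContDiffAt ℝ ∞ (fderiv ℝ P) u :=
  hP.fderiv_right (m := ∞) (by simp)

theorem contDiffAt_dirDeriv {P : E → V} {u : E} (hP : ContDiffAt ℝ ∞ P u) (a : E) :
    ContDiffAt ℝ ∞ (dirDeriv a P) u :=
  (contDiffAt_fderiv hP).clm_apply contDiffAt_const

theorem eventually_differentiableAt {P : E → V} {u : E} (hP : ContDiffAt ℝ ∞ P u) :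
    ∀ᶠ z in 𝓝 u, DifferentiableAt ℝ P z := by
  have h : ∀ᶠ z in 𝓝 u, ContDiffAt ℝ 1 P z := (hP.of_le (by simp)).eventually (by simp)
  filter_upwards [h] with z hz using hz.differentiableAt (by simp)

theorem dirDeriv_dirDeriv {P : E → V} {u : E} (hP : ContDiffAt ℝ ∞ P u) (a b : E) :
    dirDeriv a (dirDeriv b P) u = fderiv ℝ (fderiv ℝ P) u a b := by
  have h := ((contDiffAt_fderiv hP).differentiableAt (by simp)).hasFDerivAt.clm_apply
    (hasFDerivAt_const b u)
  have h2 : HasFDerivAt (dirDeriv b P) _ u := h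
  rw [dirDeriv, h2.fderiv]
  simp

theorem dirDeriv_congr {P Q : E → V} {u : E} (h : P =ᶠ[𝓝 u] Q) (a : E) :
    dirDeriv a P =ᶠ[𝓝 u] dirDeriv a Q := by
  filter_upwards [h.fderiv (𝕜 := ℝ)] with z hz
  rw [dirDeriv, dirDeriv, hz]

theorem eventually_contDiffAt {P : E → V} {u : E} (hP : ContDiffAt ℝ ∞ P u) (k : ℕ) :
    ∀ᶠ z in 𝓝 u, ContDiffAt ℝ k P z :=
  (hP.of_le (by exact_mod_cast le_top)).eventually (by simp)

/-- Symmetry is needed on a neighbourhood, not only at `u`, so that it can be differentiated again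
to permute third derivatives. -/
theorem dirDeriv_comm_eventually {P : E → V} {u : E} (hP : ContDiffAt ℝ ∞ P u) (a b : E) :
    dirDeriv a (dirDeriv b P) =ᶠ[𝓝 u] dirDeriv b (dirDeriv a P) := by
  have key : ∀ z, ContDiffAt ℝ (2 : ℕ) P z → ∀ a b,
      dirDeriv a (dirDeriv b P) z = fderiv ℝ (fderiv ℝ P) z a b := by
    intro z hz a b
    have h1 : ContDiffAt ℝ 1 (fderiv ℝ P) z := hz.fderiv_right (m := 1) (by norm_num)
    have h := (h1.differentiableAt (by simp)).hasFDerivAt.clm_apply (hasFDerivAt_const b z)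
    have h2 : HasFDerivAt (dirDeriv b P) _ z := h
    rw [dirDeriv, h2.fderiv]
    simp
  filter_upwards [eventually_contDiffAt hP 2] with z hz
  rw [key z hz, key z hz]
  exact (hz.isSymmSndFDerivAt (by simp)) a b

theorem dirDeriv_comm {P : E → V} {u : E} (hP : ContDiffAt ℝ ∞ P u) (a b : E) :
    dirDeriv a (dirDeriv b P) u = dirDeriv b (dirDeriv a P) u :=
  (dirDeriv_comm_eventually hP a b).eq_of_nhds

variable {W : Type*} [NormedAddCommGroup W] [InnerProductSpace ℝ W]

theorem dirDeriv_inner {P Q : E → W} {u : E} (hP : ContDiffAt ℝ ∞ P u) (hQ : ContDiffAt ℝ ∞ Q u)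
    (a : E) : dirDeriv a (fun z => (inner ℝ (P z) (Q z) : ℝ)) =ᶠ[𝓝 u]
      fun z => inner ℝ (dirDeriv a P z) (Q z) + inner ℝ (P z) (dirDeriv a Q z) := by
  filter_upwards [eventually_differentiableAt hP, eventually_differentiableAt hQ] with z hp hq
  rw [dirDeriv, fderiv_inner_apply ℝ hp hq, add_comm]
  rfl

theorem dirDeriv_add {P Q : E → V} {u : E} (hP : ContDiffAt ℝ ∞ P u) (hQ : ContDiffAt ℝ ∞ Q u)
    (a : E) : dirDeriv a (fun z => P z + Q z) =ᶠ[𝓝 u]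
      fun z => dirDeriv a P z + dirDeriv a Q z := by
  filter_upwards [eventually_differentiableAt hP, eventually_differentiableAt hQ] with z hp hq
  rw [dirDeriv, fderiv_fun_add hp hq]
  rfl

theorem dirDeriv_mul {P Q : E → ℝ} {u : E} (hP : ContDiffAt ℝ ∞ P u) (hQ : ContDiffAt ℝ ∞ Q u)
    (a : E) : dirDeriv a (fun z => P z * Q z) =ᶠ[𝓝 u]
      fun z => dirDeriv a P z * Q z + P z * dirDeriv a Q z := by
  filter_upwards [eventually_differentiableAt hP, eventually_differentiableAt hQ] with z hp hq
  rw [dirDeriv, fderiv_fun_mul hp hq]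
  simp [dirDeriv]
  ring

theorem dirDeriv_dirDeriv_inner {P Q : E → W} {u : E} (hP : ContDiffAt ℝ ∞ P u)
    (hQ : ContDiffAt ℝ ∞ Q u) (a b : E) :
    dirDeriv b (dirDeriv a (fun z => (inner ℝ (P z) (Q z) : ℝ))) u =
      inner ℝ (dirDeriv b (dirDeriv a P) u) (Q u) + inner ℝ (dirDeriv a P u) (dirDeriv b Q u) +
      (inner ℝ (dirDeriv b P u) (dirDeriv a Q u) + inner ℝ (P u) (dirDeriv b (dirDeriv a Q) u)) := by
  have hPa := contDiffAt_dirDeriv hP a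
  have hQa := contDiffAt_dirDeriv hQ a
  rw [(dirDeriv_congr (dirDeriv_inner hP hQ a) b).eq_of_nhds,
    (dirDeriv_add (hPa.inner ℝ hQ) (hP.inner ℝ hQa) b).eq_of_nhds,
    (dirDeriv_inner hPa hQ b).eq_of_nhds, (dirDeriv_inner hP hQa b).eq_of_nhds]

theorem dirDeriv_dirDeriv_mul {P Q : E → ℝ} {u : E} (hP : ContDiffAt ℝ ∞ P u)
    (hQ : ContDiffAt ℝ ∞ Q u) (a b : E) :
    dirDeriv b (dirDeriv a (fun z => P z * Q z)) u =
      dirDeriv b (dirDeriv a P) u * Q u + dirDeriv a P u * dirDeriv b Q u +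
      (dirDeriv b P u * dirDeriv a Q u + P u * dirDeriv b (dirDeriv a Q) u) := by
  have hPa := contDiffAt_dirDeriv hP a
  have hQa := contDiffAt_dirDeriv hQ a
  rw [(dirDeriv_congr (dirDeriv_mul hP hQ a) b).eq_of_nhds,
    (dirDeriv_add (hPa.mul hQ) (hP.mul hQa) b).eq_of_nhds,
    (dirDeriv_mul hPa hQ b).eq_of_nhds, (dirDeriv_mul hP hQa b).eq_of_nhds]

/-- Second derivatives of the equation `⟨τ_v, φ_w⟩ + ⟨φ_v, τ_w⟩ = 2 r ⟨φ_v, φ_w⟩`. -/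
theorem bending_second_derivative {φ τ : E → W} {r : E → ℝ} {u : E} (hφ : ContDiffAt ℝ ∞ φ u)
    (hτ : ContDiffAt ℝ ∞ τ u) (hr : ContDiffAt ℝ ∞ r u) {v w : E}
    (hb : ∀ᶠ z in 𝓝 u, (inner ℝ (dirDeriv v τ z) (dirDeriv w φ z) : ℝ) +
      inner ℝ (dirDeriv v φ z) (dirDeriv w τ z) =
      2 * r z * inner ℝ (dirDeriv v φ z) (dirDeriv w φ z))
    (hnormal : ∀ x y z, (inner ℝ (dirDeriv x (dirDeriv y φ) u) (dirDeriv z φ u) : ℝ) = 0)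
    (a b : E) :
    (inner ℝ (dirDeriv b (dirDeriv a (dirDeriv v τ)) u) (dirDeriv w φ u) : ℝ) +
      inner ℝ (dirDeriv a (dirDeriv v τ) u) (dirDeriv b (dirDeriv w φ) u) +
      inner ℝ (dirDeriv b (dirDeriv v τ) u) (dirDeriv a (dirDeriv w φ) u) +
      inner ℝ (dirDeriv v τ u) (dirDeriv b (dirDeriv a (dirDeriv w φ)) u) +
      inner ℝ (dirDeriv b (dirDeriv a (dirDeriv v φ)) u) (dirDeriv w τ u) +
      inner ℝ (dirDeriv a (dirDeriv v φ) u) (dirDeriv b (dirDeriv w τ) u) +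
      inner ℝ (dirDeriv b (dirDeriv v φ) u) (dirDeriv a (dirDeriv w τ) u) +
      inner ℝ (dirDeriv v φ u) (dirDeriv b (dirDeriv a (dirDeriv w τ)) u) =
    2 * dirDeriv b (dirDeriv a r) u * inner ℝ (dirDeriv v φ u) (dirDeriv w φ u) +
      2 * r u * (inner ℝ (dirDeriv b (dirDeriv a (dirDeriv v φ)) u) (dirDeriv w φ u) +
        inner ℝ (dirDeriv a (dirDeriv v φ) u) (dirDeriv b (dirDeriv w φ) u) +
        inner ℝ (dirDeriv b (dirDeriv v φ) u) (dirDeriv a (dirDeriv w φ) u) +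
        inner ℝ (dirDeriv v φ u) (dirDeriv b (dirDeriv a (dirDeriv w φ)) u)) := by
  have hφv := contDiffAt_dirDeriv hφ v
  have hφw := contDiffAt_dirDeriv hφ w
  have hτv := contDiffAt_dirDeriv hτ v
  have hτw := contDiffAt_dirDeriv hτ w
  have h2r : ContDiffAt ℝ ∞ (fun z => 2 * r z) u := contDiffAt_const.mul hr
  -- In normal coordinates the metric is stationary at `u`, so no first derivatives of `r` survive
  -- the product rule.
  have key : ∀ c, dirDeriv c (fun z => (inner ℝ (dirDeriv v φ z) (dirDeriv w φ z) : ℝ)) u = 0 := by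
    intro c
    rw [(dirDeriv_inner hφv hφw c).eq_of_nhds, hnormal, real_inner_comm, hnormal, add_zero]
  have e := (dirDeriv_congr (dirDeriv_congr (hb : _ =ᶠ[𝓝 u] _) a) b).eq_of_nhds
  have e1 : dirDeriv b (dirDeriv a (fun z => (inner ℝ (dirDeriv v τ z) (dirDeriv w φ z) : ℝ) +
      inner ℝ (dirDeriv v φ z) (dirDeriv w τ z))) u =
      dirDeriv b (dirDeriv a (fun z => (inner ℝ (dirDeriv v τ z) (dirDeriv w φ z) : ℝ))) u +
      dirDeriv b (dirDeriv a (fun z => (inner ℝ (dirDeriv v φ z) (dirDeriv w τ z) : ℝ))) u := by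
    rw [(dirDeriv_congr (dirDeriv_add (hτv.inner ℝ hφw) (hφv.inner ℝ hτw) a) b).eq_of_nhds,
      (dirDeriv_add (contDiffAt_dirDeriv (hτv.inner ℝ hφw) a)
        (contDiffAt_dirDeriv (hφv.inner ℝ hτw) a) b).eq_of_nhds]
  have e2 : dirDeriv b (dirDeriv a (fun z => 2 * r z)) u = 2 * dirDeriv b (dirDeriv a r) u := by
    have h0 : ∀ c d, dirDeriv c (fun _ : E => (d : ℝ)) = fun _ => 0 := fun c d => by
      funext z; simp [dirDeriv]
    rw [dirDeriv_dirDeriv_mul contDiffAt_const hr]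
    simp [h0]
  rw [e1, dirDeriv_dirDeriv_inner hτv hφw, dirDeriv_dirDeriv_inner hφv hτw,
    dirDeriv_dirDeriv_mul h2r (hφv.inner ℝ hφw), dirDeriv_dirDeriv_inner hφv hφw, key, key, e2] at e
  linear_combination e

/-- The linearized Gauss equation in coordinates that are normal at `u`. -/
theorem linearized_gauss_normal {φ τ : E → W} {r : E → ℝ} {u : E} (hφ : ContDiffAt ℝ ∞ φ u)
    (hτ : ContDiffAt ℝ ∞ τ u) (hr : ContDiffAt ℝ ∞ r u)
    (hb : ∀ᶠ z in 𝓝 u, ∀ v w, (inner ℝ (dirDeriv v τ z) (dirDeriv w φ z) : ℝ) +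
      inner ℝ (dirDeriv v φ z) (dirDeriv w τ z) =
      2 * r z * inner ℝ (dirDeriv v φ z) (dirDeriv w φ z))
    (hnormal : ∀ x y z, (inner ℝ (dirDeriv x (dirDeriv y φ) u) (dirDeriv z φ u) : ℝ) = 0)
    (a b : E) :
    (inner ℝ (dirDeriv a (dirDeriv b τ) u) (dirDeriv a (dirDeriv b φ) u) : ℝ) +
      inner ℝ (dirDeriv a (dirDeriv b φ) u) (dirDeriv a (dirDeriv b τ) u) -
      2 * r u * inner ℝ (dirDeriv a (dirDeriv b φ) u) (dirDeriv a (dirDeriv b φ) u) -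
      (inner ℝ (dirDeriv a (dirDeriv a τ) u) (dirDeriv b (dirDeriv b φ) u) +
      inner ℝ (dirDeriv a (dirDeriv a φ) u) (dirDeriv b (dirDeriv b τ) u) -
      2 * r u * inner ℝ (dirDeriv a (dirDeriv a φ) u) (dirDeriv b (dirDeriv b φ) u)) =
    dirDeriv a (dirDeriv a r) u * inner ℝ (dirDeriv b φ u) (dirDeriv b φ u) +
      dirDeriv b (dirDeriv b r) u * inner ℝ (dirDeriv a φ u) (dirDeriv a φ u) -
      2 * (dirDeriv a (dirDeriv b r) u * inner ℝ (dirDeriv a φ u) (dirDeriv b φ u)) := by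
  have E1 := bending_second_derivative hφ hτ hr (hb.mono fun z h => h a a) hnormal b b
  have E2 := bending_second_derivative hφ hτ hr (hb.mono fun z h => h b b) hnormal a a
  have E3 := bending_second_derivative hφ hτ hr (hb.mono fun z h => h a b) hnormal b a
  -- All third derivatives are brought to the forms `aab` and `bba` that occur in `E1` and `E2`.
  have third : ∀ {P : E → W}, ContDiffAt ℝ ∞ P u → ∀ a b,
      dirDeriv a (dirDeriv b (dirDeriv a P)) u = dirDeriv a (dirDeriv a (dirDeriv b P)) u :=
    fun hP a b => (dirDeriv_congr (dirDeriv_comm_eventually hP b a) a).eq_of_nhds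
  have third' : ∀ {P : E → W}, ContDiffAt ℝ ∞ P u → ∀ a b,
      dirDeriv a (dirDeriv b (dirDeriv b P)) u = dirDeriv b (dirDeriv b (dirDeriv a P)) u := by
    intro P hP a b
    rw [dirDeriv_comm (contDiffAt_dirDeriv hP b), third hP]
  rw [third hφ a b, third hτ a b, third' hφ a b, third' hτ a b, dirDeriv_comm hφ b a,
    dirDeriv_comm hτ b a] at E3
  rw [dirDeriv_comm hφ b a, dirDeriv_comm hτ b a] at E1
  simp only [real_inner_comm] at E1 E2 E3 ⊢
  -- This is the combination of second derivatives of the metric that gives the curvature: third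
  -- derivatives of both `φ` and `τ` cancel, and products of second derivatives remain.
  linear_combination E1 / 2 + E2 / 2 - E3

end LinearizedGauss

/-! ### Passage to normal coordinates -/

section NormalCoordinates

open Filter Topology

variable {E V : Type*} [NormedAddCommGroup E] [NormedSpace ℝ E]
  [NormedAddCommGroup V] [NormedSpace ℝ V]

/-- The change of coordinates `z ↦ u + z - Γ(z, z) / 2`, which makes coordinates with Christoffel
tensor `Γ` normal at `u`. -/
def normalChange (Γ : E →L[ℝ] E →L[ℝ] E) (u z : E) : E := u + z - (1 / 2 : ℝ) • Γ z z

theorem normalChange_zero (Γ : E →L[ℝ] E →L[ℝ] E) (u : E) : normalChange Γ u 0 = u := by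
  simp [normalChange]

theorem contDiff_normalChange (Γ : E →L[ℝ] E →L[ℝ] E) (u : E) :
    ContDiff ℝ ∞ (normalChange Γ u) :=
  (contDiff_const.add contDiff_id).sub
    ((Γ.contDiff.clm_apply contDiff_id).const_smul (1 / 2 : ℝ))

theorem fderiv_normalChange_apply {Γ : E →L[ℝ] E →L[ℝ] E} (hΓ : ∀ v w, Γ v w = Γ w v) (u v z : E) :
    fderiv ℝ (normalChange Γ u) z v = v - Γ z v := by
  have h1 : HasFDerivAt (fun z => Γ z z) _ z := Γ.hasFDerivAt.clm_apply (hasFDerivAt_id z)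
  have h2 : HasFDerivAt (normalChange Γ u) _ z :=
    ((hasFDerivAt_id z).const_add u).sub (h1.const_smul (1 / 2 : ℝ))
  rw [h2.fderiv]
  have h3 : (1 / 2 : ℝ) • (Γ z v + Γ z v) = Γ z v := by
    rw [← two_smul ℝ, smul_smul]; norm_num
  simp only [_root_.sub_apply, _root_.smul_apply, _root_.add_apply,
    ContinuousLinearMap.id_apply, ContinuousLinearMap.comp_apply, ContinuousLinearMap.flip_apply]
  rw [hΓ v z, h3]

theorem tendsto_normalChange (Γ : E →L[ℝ] E →L[ℝ] E) (u : E) :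
    Tendsto (normalChange Γ u) (𝓝 0) (𝓝 u) := by
  have := (contDiff_normalChange Γ u).continuous.tendsto 0
  rwa [normalChange_zero] at this

theorem dirDeriv_comp_normalChange {Γ : E →L[ℝ] E →L[ℝ] E} (hΓ : ∀ v w, Γ v w = Γ w v) {u : E}
    {P : E → V} (hP : ContDiffAt ℝ ∞ P u) (v : E) :
    ∀ᶠ z in 𝓝 0, dirDeriv v (P ∘ normalChange Γ u) z =
      fderiv ℝ P (normalChange Γ u z) (v - Γ z v) := by
  filter_upwards [(tendsto_normalChange Γ u).eventually (eventually_differentiableAt hP)] with z hz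
  rw [dirDeriv, fderiv_comp z hz ((contDiff_normalChange Γ u).differentiable (by simp) z),
    ContinuousLinearMap.comp_apply, fderiv_normalChange_apply hΓ]

/-- The quadratic term of the change of coordinates supplies the Christoffel correction: ordinary
second derivatives at the origin become covariant Hessians when `Γ` is the Christoffel tensor. -/
theorem dirDeriv_dirDeriv_comp_normalChange {Γ : E →L[ℝ] E →L[ℝ] E} (hΓ : ∀ v w, Γ v w = Γ w v)
    {u : E} {P : E → V} (hP : ContDiffAt ℝ ∞ P u) (v w : E) :
    dirDeriv v (dirDeriv w (P ∘ normalChange Γ u)) 0 =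
      fderiv ℝ (fderiv ℝ P) u v w - fderiv ℝ P u (Γ v w) := by
  have h1 := (dirDeriv_congr (dirDeriv_comp_normalChange hΓ hP w) v).eq_of_nhds
  rw [h1, dirDeriv]
  have hψ : HasFDerivAt (normalChange Γ u) (fderiv ℝ (normalChange Γ u) 0) 0 :=
    ((contDiff_normalChange Γ u).differentiable (by simp) 0).hasFDerivAt
  have h2 : HasFDerivAt (fderiv ℝ P) (fderiv ℝ (fderiv ℝ P) u) (normalChange Γ u 0) := by
    rw [normalChange_zero]
    exact ((contDiffAt_fderiv hP).differentiableAt (by simp)).hasFDerivAt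
  have h3 : HasFDerivAt (fun z => w - Γ z w) (-(Γ.flip w)) 0 := by
    have := (Γ.flip w).hasFDerivAt (x := (0 : E))
    simpa using this.const_sub w
  have h4 := (h2.comp 0 hψ).clm_apply h3
  rw [show (fun z => fderiv ℝ P (normalChange Γ u z) (w - Γ z w)) =
    fun z => (fderiv ℝ P ∘ normalChange Γ u) z (w - Γ z w) from rfl, h4.fderiv]
  simp [fderiv_normalChange_apply hΓ, normalChange_zero]
  abel

variable {n m : ℕ}

/-- The linearized Gauss equation for a conformal infinitesimal bending `τ` of `φ` with conformal
factor `r`. -/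
theorem linearized_gauss {φ τ : Euc n → Euc m} {r : Euc n → ℝ} {u : Euc n}
    (hφ : ContDiffAt ℝ ∞ φ u) (hτ : ContDiffAt ℝ ∞ τ u) (hr : ContDiffAt ℝ ∞ r u)
    (hA : Function.Injective (fderiv ℝ φ u))
    (hb : ∀ᶠ z in 𝓝 u, ∀ v w, (inner ℝ (fderiv ℝ τ z v) (fderiv ℝ φ z w) : ℝ) +
      inner ℝ (fderiv ℝ φ z v) (fderiv ℝ τ z w) =
      2 * r z * inner ℝ (fderiv ℝ φ z v) (fderiv ℝ φ z w)) (a b : Euc n) :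
    gaussPairing (jetSff (fderiv ℝ φ u) (fderiv ℝ (fderiv ℝ φ) u))
        (jetHess (fderiv ℝ φ u) (fderiv ℝ (fderiv ℝ φ) u) (fderiv ℝ τ u)
          (fderiv ℝ (fderiv ℝ τ) u)) (r u) a b a b -
      gaussPairing (jetSff (fderiv ℝ φ u) (fderiv ℝ (fderiv ℝ φ) u))
        (jetHess (fderiv ℝ φ u) (fderiv ℝ (fderiv ℝ φ) u) (fderiv ℝ τ u)
          (fderiv ℝ (fderiv ℝ τ) u)) (r u) a a b b =
    jetHess (fderiv ℝ φ u) (fderiv ℝ (fderiv ℝ φ) u) (fderiv ℝ r u) (fderiv ℝ (fderiv ℝ r) u) a a *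
        jetMetric (fderiv ℝ φ u) b b +
      jetHess (fderiv ℝ φ u) (fderiv ℝ (fderiv ℝ φ) u) (fderiv ℝ r u) (fderiv ℝ (fderiv ℝ r) u)
        b b * jetMetric (fderiv ℝ φ u) a a -
      2 * (jetHess (fderiv ℝ φ u) (fderiv ℝ (fderiv ℝ φ) u) (fderiv ℝ r u)
        (fderiv ℝ (fderiv ℝ r) u) a b * jetMetric (fderiv ℝ φ u) a b) := by
  -- The tangential part of the second derivative of `φ`, that is the Christoffel tensor of the
  -- induced metric at `u`.
  set Γ : Euc n →L[ℝ] Euc n →L[ℝ] Euc n :=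
    (ContinuousLinearMap.compL ℝ (Euc n) (Euc m) (Euc n) (jetProj (fderiv ℝ φ u))).comp
      (fderiv ℝ (fderiv ℝ φ) u) with hΓdef
  have hΓa : ∀ v w, Γ v w = jetProj (fderiv ℝ φ u) (fderiv ℝ (fderiv ℝ φ) u v w) :=
    fun v w => rfl
  have hΓ : ∀ v w, Γ v w = Γ w v := by
    intro v w
    rw [hΓa, hΓa, ← dirDeriv_dirDeriv hφ, dirDeriv_comm hφ, dirDeriv_dirDeriv hφ]
  have hsmooth : ∀ {V : Type} [NormedAddCommGroup V] [NormedSpace ℝ V] {P : Euc n → V},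
      ContDiffAt ℝ ∞ P u → ContDiffAt ℝ ∞ (P ∘ normalChange Γ u) 0 := by
    intro V _ _ P hP
    refine ContDiffAt.comp 0 ?_ (contDiff_normalChange Γ u).contDiffAt
    rwa [normalChange_zero]
  have h0 : ∀ {V : Type} [NormedAddCommGroup V] [NormedSpace ℝ V] {P : Euc n → V},
      ContDiffAt ℝ ∞ P u → ∀ v, dirDeriv v (P ∘ normalChange Γ u) 0 = fderiv ℝ P u v := by
    intro V _ _ P hP v
    rw [(dirDeriv_comp_normalChange hΓ hP v).self_of_nhds, normalChange_zero]
    simp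
  have hαφ : ∀ v w, dirDeriv v (dirDeriv w (φ ∘ normalChange Γ u)) 0 =
      jetSff (fderiv ℝ φ u) (fderiv ℝ (fderiv ℝ φ) u) v w :=
    dirDeriv_dirDeriv_comp_normalChange hΓ hφ
  have hατ : ∀ v w, dirDeriv v (dirDeriv w (τ ∘ normalChange Γ u)) 0 =
      jetHess (fderiv ℝ φ u) (fderiv ℝ (fderiv ℝ φ) u) (fderiv ℝ τ u)
          (fderiv ℝ (fderiv ℝ τ) u) v w :=
    dirDeriv_dirDeriv_comp_normalChange hΓ hτ
  have hαr : ∀ v w, dirDeriv v (dirDeriv w (r ∘ normalChange Γ u)) 0 =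
      jetHess (fderiv ℝ φ u) (fderiv ℝ (fderiv ℝ φ) u) (fderiv ℝ r u)
          (fderiv ℝ (fderiv ℝ r) u) v w :=
    dirDeriv_dirDeriv_comp_normalChange hΓ hr
  have hd : ∀ᶠ z in 𝓝 (0 : Euc n), ∀ v,
      dirDeriv v (φ ∘ normalChange Γ u) z = fderiv ℝ φ (normalChange Γ u z) (v - Γ z v) ∧
      dirDeriv v (τ ∘ normalChange Γ u) z = fderiv ℝ τ (normalChange Γ u z) (v - Γ z v) := by
    filter_upwards [(tendsto_normalChange Γ u).eventually (eventually_differentiableAt hφ),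
      (tendsto_normalChange Γ u).eventually (eventually_differentiableAt hτ)] with z hz1 hz2 v
    have hψ := (contDiff_normalChange Γ u).differentiable (by simp) z
    constructor
    · rw [dirDeriv, fderiv_comp z hz1 hψ, ContinuousLinearMap.comp_apply, fderiv_normalChange_apply hΓ]
    · rw [dirDeriv, fderiv_comp z hz2 hψ, ContinuousLinearMap.comp_apply, fderiv_normalChange_apply hΓ]
  -- The bending equation is tensorial, so it holds for the transformed directions `v - Γ z v`. The
  -- second derivatives of the transformed `φ` at `0` are values of the second fundamental form,
  -- hence normal.
  have main := linearized_gauss_normal (hsmooth hφ) (hsmooth hτ) (hsmooth hr) (by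
      filter_upwards [hd, (tendsto_normalChange Γ u).eventually hb] with z hz hbz v w
      rw [(hz v).1, (hz v).2, (hz w).1, (hz w).2]
      exact hbz _ _) (by
      intro x y z
      rw [hαφ, h0 hφ]
      exact inner_jetSff hA _ _ _ _) a b
  simp only [hαφ, hατ, hαr, h0 hφ, Function.comp_apply, normalChange_zero] at main
  simp only [gaussPairing, jetMetric_apply]
  exact main

end NormalCoordinates

/-! ### Commuting parameter and space derivatives -/

section MixedPartials

open Filter Topology

variable {E V : Type*} [NormedAddCommGroup E] [NormedSpace ℝ E]
  [NormedAddCommGroup V] [NormedSpace ℝ V]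

theorem fderiv_snd_eq {Φ : ℝ × E → V} {t : ℝ} {u : E} (h : DifferentiableAt ℝ Φ (t, u)) :
    fderiv ℝ (fun u => Φ (t, u)) u = (fderiv ℝ Φ (t, u)).comp (ContinuousLinearMap.inr ℝ ℝ E) :=
  (h.hasFDerivAt.comp u (hasFDerivAt_prodMk_right t u)).fderiv

theorem hasDerivAt_fst {Φ : ℝ × E → V} {t : ℝ} {u : E} (h : DifferentiableAt ℝ Φ (t, u)) :
    HasDerivAt (fun t => Φ (t, u)) (fderiv ℝ Φ (t, u) (1, 0)) t := by
  have h1 : HasDerivAt (fun t => Φ (t, u)) _ t :=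
    (h.hasFDerivAt.comp t (hasFDerivAt_prodMk_left t u)).hasDerivAt
  simpa using h1

theorem contDiffAt_partial {Φ : ℝ × E → V} {p : ℝ × E} (h : ContDiffAt ℝ ∞ Φ p) :
    ContDiffAt ℝ ∞ (fun q : ℝ × E => fderiv ℝ (fun u => Φ (q.1, u)) q.2) p := by
  have h1 : ContDiffAt ℝ ∞
      (fun q : ℝ × E => (fderiv ℝ Φ q).comp (ContinuousLinearMap.inr ℝ ℝ E)) p :=
    (contDiffAt_fderiv h).clm_comp contDiffAt_const
  refine h1.congr_of_eventuallyEq ?_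
  filter_upwards [eventually_differentiableAt h] with q hq using fderiv_snd_eq hq

theorem contDiffAt_deriv_fst {Φ : ℝ × E → V} {t : ℝ} {u : E} (h : ContDiffAt ℝ ∞ Φ (t, u)) :
    ContDiffAt ℝ ∞ (fun u => deriv (fun t => Φ (t, u)) t) u := by
  have h1 : ContDiffAt ℝ ∞ (fun u : E => fderiv ℝ Φ (t, u) (1, 0)) u :=
    ((contDiffAt_fderiv h).comp u (contDiffAt_const.prodMk contDiffAt_id)).clm_apply
      contDiffAt_const
  refine h1.congr_of_eventuallyEq ?_
  have h2 : Tendsto (fun u' : E => (t, u')) (𝓝 u) (𝓝 (t, u)) :=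
    (Continuous.prodMk_right t).tendsto u
  filter_upwards [h2.eventually (eventually_differentiableAt h)] with u' hu'
    using (hasDerivAt_fst hu').deriv

/-- Derivatives in the parameter and in space commute. -/
theorem hasDerivAt_fderiv_snd {Φ : ℝ × E → V} {t : ℝ} {u : E} (h : ContDiffAt ℝ ∞ Φ (t, u)) :
    HasDerivAt (fun t => fderiv ℝ (fun u => Φ (t, u)) u)
      (fderiv ℝ (fun u => deriv (fun t => Φ (t, u)) t) u) t := by
  have h2 : Tendsto (fun u' : E => (t, u')) (𝓝 u) (𝓝 (t, u)) :=
    (Continuous.prodMk_right t).tendsto u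
  have hD : DifferentiableAt ℝ (fderiv ℝ Φ) (t, u) :=
    (contDiffAt_fderiv h).differentiableAt (by simp)
  have e1 : (fun u => deriv (fun t => Φ (t, u)) t) =ᶠ[𝓝 u] fun u => fderiv ℝ Φ (t, u) (1, 0) := by
    filter_upwards [h2.eventually (eventually_differentiableAt h)] with u' hu'
      using (hasDerivAt_fst hu').deriv
  have hp := contDiffAt_partial h
  have h3 := hasDerivAt_fst (hp.differentiableAt (by simp))
  refine h3.congr_deriv ?_
  ext v
  rw [e1.fderiv_eq]
  have e2 : (fun q : ℝ × E => fderiv ℝ (fun u => Φ (q.1, u)) q.2) =ᶠ[𝓝 (t, u)]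
      fun q => (fderiv ℝ Φ q).comp (ContinuousLinearMap.inr ℝ ℝ E) := by
    filter_upwards [eventually_differentiableAt h] with q hq using fderiv_snd_eq hq
  rw [e2.fderiv_eq]
  have e3 : HasFDerivAt (fun q : ℝ × E => (fderiv ℝ Φ q).comp (ContinuousLinearMap.inr ℝ ℝ E)) _
      (t, u) := hD.hasFDerivAt.clm_comp (hasFDerivAt_const _ _)
  have e4 : HasFDerivAt (fun u : E => fderiv ℝ Φ (t, u) (1, 0)) _ u :=
    (hD.hasFDerivAt.comp u (hasFDerivAt_prodMk_right t u)).clm_apply (hasFDerivAt_const _ _)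
  rw [e3.fderiv, e4.fderiv]
  -- Symmetry of the joint second derivative in the directions of the parameter and of `v`.
  have hs := dirDeriv_comm h (1, 0) (0, v)
  rw [dirDeriv_dirDeriv h, dirDeriv_dirDeriv h] at hs
  simpa using hs

/-- The first-order statement is applied to the space derivative. Smoothness at nearby points is
needed because its parameter derivative must be identified on a neighbourhood before differentiating
in space. -/
theorem hasDerivAt_fderiv_fderiv_snd {Φ : ℝ × E → V} {t : ℝ} {u : E}
    (h : ContDiffAt ℝ ∞ Φ (t, u)) (h' : ∀ᶠ u' in 𝓝 u, ContDiffAt ℝ ∞ Φ (t, u')) :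
    HasDerivAt (fun t => fderiv ℝ (fderiv ℝ (fun u => Φ (t, u))) u)
      (fderiv ℝ (fderiv ℝ (fun u => deriv (fun t => Φ (t, u)) t)) u) t := by
  have h1 := hasDerivAt_fderiv_snd (contDiffAt_partial h)
  have h2 : (fun u' => deriv (fun t => fderiv ℝ (fun u => Φ (t, u)) u') t) =ᶠ[𝓝 u]
      fderiv ℝ (fun u => deriv (fun t => Φ (t, u)) t) := by
    filter_upwards [h'] with u' hu' using (hasDerivAt_fderiv_snd hu').deriv
  simp only at h1
  rw [h2.fderiv_eq] at h1
  exact h1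

end MixedPartials

/-! ### From the manifold to 2-jets in a chart -/

section Charts

open Filter Topology

variable {n m : ℕ} {M : Type*} [TopologicalSpace M] [ChartedSpace (Euc n) M]
  {V : Type*} [NormedAddCommGroup V] [NormedSpace ℝ V]

/-- A map read in the preferred chart at `x`. -/
def chartRep (x : M) (h : M → V) : Euc n → V := h ∘ (extChartAt (𝓡 n) x).symm

theorem contMDiffAt_of_chartRep {x : M} {h : M → V}
    (hh : ContDiffAt ℝ ∞ (chartRep x h) (extChartAt (𝓡 n) x x)) :
    ContMDiffAt (𝓡 n) 𝓘(ℝ, V) ∞ h x := by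
  have h1 : ContMDiffAt (𝓡 n) 𝓘(ℝ, V) ∞ (chartRep x h ∘ extChartAt (𝓡 n) x) x :=
    hh.contMDiffAt.comp x contMDiffAt_extChartAt
  refine h1.congr_of_eventuallyEq ?_
  filter_upwards [extChartAt_source_mem_nhds (I := 𝓡 n) x] with y hy
  simp only [chartRep, Function.comp_apply]
  rw [(extChartAt (𝓡 n) x).left_inv hy]

theorem mdifferentiableAt_of_smooth {x : M} {h : M → V} (hh : ContMDiffAt (𝓡 n) 𝓘(ℝ, V) ∞ h x) :
    MDifferentiableAt (𝓡 n) 𝓘(ℝ, V) h x :=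
  hh.mdifferentiableAt (by simp)

theorem diff_eq_fderiv {x : M} {h : M → V} (hh : ContMDiffAt (𝓡 n) 𝓘(ℝ, V) ∞ h x) :
    diff h x = fderiv ℝ (chartRep x h) (extChartAt (𝓡 n) x x) := by
  rw [diff, (mdifferentiableAt_of_smooth hh).mfderiv]
  simp only [ModelWithCorners.range_eq_univ, fderivWithin_univ]
  rfl

theorem inducedMetric_eq_jetMetric {h : M → Euc m} {x : M}
    (hh : ContMDiffAt (𝓡 n) 𝓘(ℝ, Euc m) ∞ h x) :
    inducedMetric h x = jetMetric (fderiv ℝ (chartRep x h) (extChartAt (𝓡 n) x x)) := by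
  rw [inducedMetric, diff_eq_fderiv hh]
  rfl

variable [IsManifold (𝓡 n) ∞ M]

theorem contMDiffAt_chart_symm {x : M} {u : Euc n} (hu : u ∈ (extChartAt (𝓡 n) x).target) :
    ContMDiffAt 𝓘(ℝ, Euc n) (𝓡 n) ∞ (extChartAt (𝓡 n) x).symm u :=
  (contMDiffOn_extChartAt_symm x).contMDiffAt ((isOpen_extChartAt_target x).mem_nhds hu)

theorem contDiffAt_chartRep {x : M} {u : Euc n} (hu : u ∈ (extChartAt (𝓡 n) x).target)
    {h : M → V} (hh : ContMDiffAt (𝓡 n) 𝓘(ℝ, V) ∞ h ((extChartAt (𝓡 n) x).symm u)) :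
    ContDiffAt ℝ ∞ (chartRep x h) u :=
  (hh.comp u (contMDiffAt_chart_symm hu)).contDiffAt

theorem diff_chartInvDiff {x : M} {u : Euc n} (hu : u ∈ (extChartAt (𝓡 n) x).target)
    {h : M → V} (hh : ContMDiffAt (𝓡 n) 𝓘(ℝ, V) ∞ h ((extChartAt (𝓡 n) x).symm u)) (v : Euc n) :
    diff h ((extChartAt (𝓡 n) x).symm u) (chartInvDiff x u v) = fderiv ℝ (chartRep x h) u v := by
  have h1 := mfderiv_comp u (mdifferentiableAt_of_smooth hh)
    ((contMDiffAt_chart_symm hu).mdifferentiableAt (by simp))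
  rw [mfderiv_eq_fderiv] at h1
  exact (DFunLike.congr_fun h1 v).symm

/-- Stated on the whole chart target because the Christoffel symbols differentiate the metric. -/
theorem chartMetric_inducedMetric {h : M → Euc m} (hh : ContMDiff (𝓡 n) 𝓘(ℝ, Euc m) ∞ h) {x : M}
    {u : Euc n} (hu : u ∈ (extChartAt (𝓡 n) x).target) :
    chartMetric (inducedMetric h) x u = jetMetric (fderiv ℝ (chartRep x h) u) := by
  ext v w
  have h1 := diff_chartInvDiff hu (hh _) v
  have h2 := diff_chartInvDiff hu (hh _) w
  rw [jetMetric_apply, ← h1, ← h2]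
  rfl

theorem smooth_chartRep {h : M → V} (hh : ContMDiff (𝓡 n) 𝓘(ℝ, V) ∞ h) (x : M) :
    ContDiffAt ℝ ∞ (chartRep x h) (extChartAt (𝓡 n) x x) :=
  contDiffAt_chartRep (mem_extChartAt_target x) (hh _)

/-- Expanding the three metric derivatives by the product rule, symmetry of second derivatives
cancels all but one term of the Koszul formula. -/
theorem christoffelLow_inducedMetric {h : M → Euc m} (hh : ContMDiff (𝓡 n) 𝓘(ℝ, Euc m) ∞ h)
    (x : M) (v w y : Euc n) :
    christoffelLow (inducedMetric h) x v w y =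
      inner ℝ (fderiv ℝ (fderiv ℝ (chartRep x h)) (extChartAt (𝓡 n) x x) v w)
        (fderiv ℝ (chartRep x h) (extChartAt (𝓡 n) x x) y) := by
  set u := extChartAt (𝓡 n) x x
  set φ : Euc n → Euc m := chartRep x h
  have hφ : ContDiffAt ℝ ∞ φ u := smooth_chartRep hh x
  have hB : HasFDerivAt (fderiv ℝ φ) (fderiv ℝ (fderiv ℝ φ) u) u :=
    ((contDiffAt_fderiv hφ).differentiableAt (by simp)).hasFDerivAt
  have hev : chartMetric (inducedMetric h) x =ᶠ[𝓝 u] fun z => jetMetric (fderiv ℝ φ z) := by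
    filter_upwards [extChartAt_target_mem_nhds (I := 𝓡 n) x] with z hz
      using chartMetric_inducedMetric hh hz
  have hd : DifferentiableAt ℝ (fun z => jetMetric (fderiv ℝ φ z)) u := by
    have e : (fun z => jetMetric (fderiv ℝ φ z)) = fun z =>
        ((ContinuousLinearMap.compL ℝ (Euc n) (Euc m) ℝ).flip (fderiv ℝ φ z)).comp
          ((innerSL ℝ : Euc m →L[ℝ] Euc m →L[ℝ] ℝ).comp (fderiv ℝ φ z)) := by
      funext z
      ext v w
      rfl
    rw [e]
    have h1 := hB.differentiableAt
    fun_prop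
  have key : ∀ a b c, fderiv ℝ (chartMetric (inducedMetric h) x) u a b c =
      inner ℝ (fderiv ℝ (fderiv ℝ φ) u a b) (fderiv ℝ φ u c) +
        inner ℝ (fderiv ℝ φ u b) (fderiv ℝ (fderiv ℝ φ) u a c) := by
    intro a b c
    rw [hev.fderiv_eq]
    have h1 : HasFDerivAt (fun z => jetMetric (fderiv ℝ φ z) b c) _ u :=
      (hd.hasFDerivAt.clm_apply (hasFDerivAt_const b u)).clm_apply (hasFDerivAt_const c u)
    have h2 : HasFDerivAt (fun z => jetMetric (fderiv ℝ φ z) b c) _ u :=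
      (hB.clm_apply (hasFDerivAt_const b u)).inner ℝ (hB.clm_apply (hasFDerivAt_const c u))
    have h3 := DFunLike.congr_fun (h1.unique h2) a
    simp only [ContinuousLinearMap.comp_zero, zero_add, ContinuousLinearMap.flip_apply,
      ContinuousLinearMap.comp_apply, ContinuousLinearMap.prod_apply,
      fderivInnerCLM_apply] at h3
    rw [h3]
    exact add_comm _ _
  have hs : ∀ a b, fderiv ℝ (fderiv ℝ φ) u a b = fderiv ℝ (fderiv ℝ φ) u b a := by
    intro a b
    rw [← dirDeriv_dirDeriv hφ, dirDeriv_comm hφ, dirDeriv_dirDeriv hφ]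
  rw [christoffelLow, key, key, key, hs w v, hs y v, hs y w,
    real_inner_comm (fderiv ℝ φ u w) (fderiv ℝ (fderiv ℝ φ) u v y)]
  ring

theorem christoffel_inducedMetric {h : M → Euc m} (hh : ContMDiff (𝓡 n) 𝓘(ℝ, Euc m) ∞ h)
    (x : M) (v w : Euc n) :
    christoffel (inducedMetric h) x v w =
      jetProj (fderiv ℝ (chartRep x h) (extChartAt (𝓡 n) x x))
        (fderiv ℝ (fderiv ℝ (chartRep x h)) (extChartAt (𝓡 n) x x) v w) := by
  rw [christoffel, jetProj_apply]
  simp only [chartMetric_inducedMetric hh (mem_extChartAt_target x),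
    christoffelLow_inducedMetric hh, real_inner_comm]

/-- Raising an index turns the lowered Christoffel symbols into `jetProj`, so the intrinsic Hessian
agrees with its 2-jet version. -/
theorem hess_inducedMetric {h : M → Euc m} (hh : ContMDiff (𝓡 n) 𝓘(ℝ, Euc m) ∞ h)
    (x : M) (T : M → V) :
    hess (inducedMetric h) T x = jetHess (fderiv ℝ (chartRep x h) (extChartAt (𝓡 n) x x))
        (fderiv ℝ (fderiv ℝ (chartRep x h)) (extChartAt (𝓡 n) x x))
        (fderiv ℝ (chartRep x T) (extChartAt (𝓡 n) x x))
        (fderiv ℝ (fderiv ℝ (chartRep x T)) (extChartAt (𝓡 n) x x)) := by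
  funext v w
  rw [hess, christoffel_inducedMetric hh]
  rfl

theorem secondFF_eq_jetSff {h : M → Euc m} (hh : ContMDiff (𝓡 n) 𝓘(ℝ, Euc m) ∞ h) (x : M) :
    secondFF h x = jetSff (fderiv ℝ (chartRep x h) (extChartAt (𝓡 n) x x))
        (fderiv ℝ (fderiv ℝ (chartRep x h)) (extChartAt (𝓡 n) x x)) := by
  funext v w
  rw [secondFF, hess_inducedMetric hh]
  rfl

theorem meanCurv_eq_jetMeanCurv {h : M → Euc m} (hh : ContMDiff (𝓡 n) 𝓘(ℝ, Euc m) ∞ h) (x : M) :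
    meanCurv (n := n) h x = jetMeanCurv (fderiv ℝ (chartRep x h) (extChartAt (𝓡 n) x x))
        (fderiv ℝ (fderiv ℝ (chartRep x h)) (extChartAt (𝓡 n) x x)) := by
  rw [meanCurv, secondFF_eq_jetSff hh, inducedMetric_eq_jetMetric (hh x)]
  rfl

theorem phiSq_eq_jetPhiSq {h : M → Euc m} (hh : ContMDiff (𝓡 n) 𝓘(ℝ, Euc m) ∞ h) (x : M) :
    phiSq (n := n) h x = jetPhiSq (fderiv ℝ (chartRep x h) (extChartAt (𝓡 n) x x))
        (fderiv ℝ (fderiv ℝ (chartRep x h)) (extChartAt (𝓡 n) x x)) := by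
  rw [phiSq, meanCurv_eq_jetMeanCurv hh, secondFFNormSq, secondFF_eq_jetSff hh,
    inducedMetric_eq_jetMetric (hh x)]
  rfl

theorem phiSq_ne_zero (hn : 2 ≤ n) {h : M → Euc m} (hh : ContMDiff (𝓡 n) 𝓘(ℝ, Euc m) ∞ h) {x : M}
    (hinj : Function.Injective (diff (n := n) h x)) (humb : ¬ IsUmbilic (n := n) h x) :
    phiSq (n := n) h x ≠ 0 := by
  intro h0
  apply humb
  intro v w
  rw [phiSq_eq_jetPhiSq hh] at h0
  rw [diff_eq_fderiv (hh x)] at hinj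
  rw [secondFF_eq_jetSff hh, meanCurv_eq_jetMeanCurv hh, inducedMetric_eq_jetMetric (hh x)]
  exact umbilic_of_jetPhiSq_eq_zero hn hinj _ h0 v w

end Charts

/-! ### Variations of an immersion and the derivative of `φ²` on `M` -/

section Variations

open Filter Topology

variable {n m : ℕ} {M : Type*} [TopologicalSpace M] [ChartedSpace (Euc n) M]
  {f : M → Euc m} {ε : ℝ} {F : ℝ → M → Euc m}

theorem IsVariation.contMDiffAt (hF : IsVariation (n := n) f ε F) {t : ℝ} (ht : t ∈ Ioo (-ε) ε)
    (x : M) : ContMDiffAt (𝓘(ℝ, ℝ).prod (𝓡 n)) 𝓘(ℝ, Euc m) ∞ (fun p : ℝ × M => F p.1 p.2) (t, x) :=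
  hF.smooth.contMDiffAt ((isOpen_Ioo.prod isOpen_univ).mem_nhds ⟨ht, mem_univ _⟩)

theorem IsVariation.contMDiff (hF : IsVariation (n := n) f ε F) {t : ℝ} (ht : t ∈ Ioo (-ε) ε) :
    ContMDiff (𝓡 n) 𝓘(ℝ, Euc m) ∞ (F t) := fun x =>
  (hF.contMDiffAt ht x).comp x (contMDiffAt_const.prodMk contMDiffAt_id)

theorem IsVariation.zero_mem (hF : IsVariation (n := n) f ε F) : (0 : ℝ) ∈ Ioo (-ε) ε :=
  ⟨neg_lt_zero.mpr hF.pos, hF.pos⟩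

theorem IsVariation.eventually_mem (hF : IsVariation (n := n) f ε F) :
    ∀ᶠ t in 𝓝 (0 : ℝ), t ∈ Ioo (-ε) ε := isOpen_Ioo.mem_nhds hF.zero_mem

theorem IsVariation.injective_fderiv (hF : IsVariation (n := n) f ε F) (x : M) :
    Function.Injective (fderiv ℝ (chartRep x (F 0)) (extChartAt (𝓡 n) x x)) := by
  have h := hF.immersion 0 hF.zero_mem x
  rwa [diff_eq_fderiv (hF.contMDiff hF.zero_mem x)] at h

variable [IsManifold (𝓡 n) ∞ M]

theorem IsVariation.contDiffAt_chart (hF : IsVariation (n := n) f ε F) {t : ℝ}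
    (ht : t ∈ Ioo (-ε) ε) {x : M} {u : Euc n} (hu : u ∈ (extChartAt (𝓡 n) x).target) :
    ContDiffAt ℝ ∞ (fun p : ℝ × Euc n => chartRep x (F p.1) p.2) (t, u) := by
  have h1 : ContMDiffAt 𝓘(ℝ, ℝ × Euc n) (𝓘(ℝ, ℝ).prod (𝓡 n)) ∞
      (fun p : ℝ × Euc n => (p.1, (extChartAt (𝓡 n) x).symm p.2)) (t, u) := by
    refine ContMDiffAt.prodMk contDiff_fst.contMDiff.contMDiffAt ?_
    exact ContMDiffAt.comp (t, u) (contMDiffAt_chart_symm hu) contDiff_snd.contMDiff.contMDiffAt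
  exact (ContMDiffAt.comp (t, u) (hF.contMDiffAt ht ((extChartAt (𝓡 n) x).symm u)) h1).contDiffAt

theorem IsVariation.contMDiff_variationalField (hF : IsVariation (n := n) f ε F) :
    ContMDiff (𝓡 n) 𝓘(ℝ, Euc m) ∞ (variationalField F) := fun x =>
  contMDiffAt_of_chartRep
    (contDiffAt_deriv_fst (hF.contDiffAt_chart hF.zero_mem (mem_extChartAt_target x)))

theorem IsVariation.hasDerivAt_fderiv (hF : IsVariation (n := n) f ε F) (x : M) :
    HasDerivAt (fun t => fderiv ℝ (chartRep x (F t)) (extChartAt (𝓡 n) x x))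
      (fderiv ℝ (chartRep x (variationalField F)) (extChartAt (𝓡 n) x x)) 0 :=
  hasDerivAt_fderiv_snd (hF.contDiffAt_chart hF.zero_mem (mem_extChartAt_target x))

theorem IsVariation.hasDerivAt_fderiv_fderiv (hF : IsVariation (n := n) f ε F) (x : M) :
    HasDerivAt (fun t => fderiv ℝ (fderiv ℝ (chartRep x (F t))) (extChartAt (𝓡 n) x x))
      (fderiv ℝ (fderiv ℝ (chartRep x (variationalField F))) (extChartAt (𝓡 n) x x)) 0 := by
  refine hasDerivAt_fderiv_fderiv_snd (hF.contDiffAt_chart hF.zero_mem (mem_extChartAt_target x)) ?_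
  filter_upwards [extChartAt_target_mem_nhds (I := 𝓡 n) x] with u hu
    using hF.contDiffAt_chart hF.zero_mem hu

theorem IsVariation.phiSq_eventuallyEq (hF : IsVariation (n := n) f ε F) (x : M) :
    (fun t => phiSq (n := n) (F t) x) =ᶠ[𝓝 0] fun t =>
      jetPhiSq (fderiv ℝ (chartRep x (F t)) (extChartAt (𝓡 n) x x))
        (fderiv ℝ (fderiv ℝ (chartRep x (F t))) (extChartAt (𝓡 n) x x)) := by
  filter_upwards [hF.eventually_mem] with t ht using phiSq_eq_jetPhiSq (hF.contMDiff ht) x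

theorem IsVariation.differentiableAt_phiSq (hF : IsVariation (n := n) f ε F) (x : M) :
    DifferentiableAt ℝ (fun t => phiSq (n := n) (F t) x) 0 :=
  (differentiableAt_jetPhiSq (hF.hasDerivAt_fderiv x) (hF.hasDerivAt_fderiv_fderiv x)
    (hF.injective_fderiv x)).congr_of_eventuallyEq (hF.phiSq_eventuallyEq x)

theorem IsVariation.hasDerivAt_inducedMetric (hF : IsVariation (n := n) f ε F) (x : M)
    (v w : Euc n) :
    HasDerivAt (fun t => inducedMetric (F t) x v w)
      (inner ℝ (diff (variationalField F) x v) (diff f x w) +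
        inner ℝ (diff f x v) (diff (variationalField F) x w)) 0 := by
  have h := hasDerivAt_jetMetric (hF.hasDerivAt_fderiv x) v w
  rw [diff_eq_fderiv (hF.contMDiff_variationalField x), ← hF.zero,
    diff_eq_fderiv (hF.contMDiff hF.zero_mem x)]
  refine h.congr_of_eventuallyEq ?_
  filter_upwards [hF.eventually_mem] with t ht
  rw [inducedMetric_eq_jetMetric (hF.contMDiff ht x)]

/-- The bending equation read in a chart. -/
theorem bending_chart {T : M → Euc m} {ρ : M → ℝ}
    (hf : ContMDiff (𝓡 n) 𝓘(ℝ, Euc m) ∞ f) (hT : ContMDiff (𝓡 n) 𝓘(ℝ, Euc m) ∞ T)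
    (hb : ∀ (x : M) (v w : Euc n), inner ℝ (diff T x v) (diff f x w) +
      inner ℝ (diff f x v) (diff T x w) = 2 * ρ x * inducedMetric f x v w) {x : M} {u : Euc n}
    (hu : u ∈ (extChartAt (𝓡 n) x).target) (v w : Euc n) :
    (inner ℝ (fderiv ℝ (chartRep x T) u v) (fderiv ℝ (chartRep x f) u w) : ℝ) +
      inner ℝ (fderiv ℝ (chartRep x f) u v) (fderiv ℝ (chartRep x T) u w) =
    2 * chartRep x ρ u *
      inner ℝ (fderiv ℝ (chartRep x f) u v) (fderiv ℝ (chartRep x f) u w) := by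
  have h := hb ((extChartAt (𝓡 n) x).symm u) (chartInvDiff x u v) (chartInvDiff x u w)
  rw [diff_chartInvDiff hu (hf _), diff_chartInvDiff hu (hf _),
    diff_chartInvDiff hu (hT _), diff_chartInvDiff hu (hT _)] at h
  rw [h, ← diff_chartInvDiff hu (hf _), ← diff_chartInvDiff hu (hf _)]
  rfl

/-- The variation of `φ²` under a variation in the direction of a conformal infinitesimal
bending. -/
theorem hasDerivAt_phiSq (hn : 2 ≤ n) {ρ : M → ℝ} (hF : IsVariation (n := n) f ε F)
    (hT : IsConformalInfinitesimalBending (inducedMetric f : BilinField n M) f (variationalField F) ρ) (x : M) :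
    HasDerivAt (fun t => phiSq (n := n) (F t) x)
      (2 * n * laplacian (inducedMetric f : BilinField n M) ρ x - 2 * phiSq (n := n) f x * ρ x +
        2 * n ^ 2 * inner ℝ (normalizedTraceBeta (inducedMetric f : BilinField n M) f (variationalField F) ρ x)
          (meanCurv (n := n) f x)) 0 := by
  have hf : ContMDiff (𝓡 n) 𝓘(ℝ, Euc m) ∞ f := by
    have := hF.contMDiff hF.zero_mem
    rwa [hF.zero] at this
  have hρ : chartRep x ρ (extChartAt (𝓡 n) x x) = ρ x := by
    simp [chartRep]
  have hb : ∀ᶠ u in 𝓝 (extChartAt (𝓡 n) x x), ∀ v w,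
      (inner ℝ (fderiv ℝ (chartRep x (variationalField F)) u v) (fderiv ℝ (chartRep x f) u w) : ℝ) +
      inner ℝ (fderiv ℝ (chartRep x f) u v) (fderiv ℝ (chartRep x (variationalField F)) u w) =
      2 * chartRep x ρ u *
      inner ℝ (fderiv ℝ (chartRep x f) u v) (fderiv ℝ (chartRep x f) u w) := by
    filter_upwards [extChartAt_target_mem_nhds (I := 𝓡 n) x] with u hu v w 
      using bending_chart hf hT.smooth hT.bending hu v w
  have hinj := hF.injective_fderiv x
  have h0 := hF.zero
  have main := hasDerivAt_jetPhiSq hn (hF.hasDerivAt_fderiv x) (hF.hasDerivAt_fderiv_fderiv x)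
    hinj (r := ρ x) (R' := fderiv ℝ (chartRep x ρ) (extChartAt (𝓡 n) x x))
    (R'' := fderiv ℝ (fderiv ℝ (chartRep x ρ)) (extChartAt (𝓡 n) x x))
    (by
      intro v w
      rw [h0, jetMetric_apply, ← hρ]
      exact hb.self_of_nhds v w)
    (by
      intro v w
      rw [h0] at hinj ⊢
      rw [← hρ]
      exact linearized_gauss (smooth_chartRep hf x) (smooth_chartRep hT.smooth x)
        (smooth_chartRep hT.smooth_factor x) hinj hb v w)
  refine (main.congr_of_eventuallyEq (hF.phiSq_eventuallyEq x)).congr_deriv ?_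
  rw [h0, laplacian, normalizedTraceBeta, phiSq_eq_jetPhiSq hf, meanCurv_eq_jetMeanCurv hf,
    hess_inducedMetric hf, inducedMetric_eq_jetMetric (hf x)]
  have hN : normalSpace (n := n) f x =
      ((fderiv ℝ (chartRep x f) (extChartAt (𝓡 n) x x)).toLinearMap.range)ᗮ := by
    rw [normalSpace, diff_eq_fderiv (hf x)]
  unfold betaTensor
  simp only [hN, hess_inducedMetric hf, secondFF_eq_jetSff hf]

end Variations

/-! ### Small positive functions adapted to an immersion -/

section Domination

open Filter Topology

variable {n m : ℕ} {M : Type*} [TopologicalSpace M] [ChartedSpace (Euc n) M]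

theorem chartRep_eventuallyEq {V : Type*} {x : M} {h k : M → V} (hhk : h =ᶠ[𝓝 x] k) :
    chartRep x h =ᶠ[𝓝 (extChartAt (𝓡 n) x x)] chartRep x k := by
  have h1 : Tendsto (extChartAt (𝓡 n) x).symm (𝓝 (extChartAt (𝓡 n) x x)) (𝓝 x) := by
    have := continuousAt_extChartAt_symm (I := 𝓡 n) x
    rwa [ContinuousAt, extChartAt_to_inv] at this
  exact h1.eventually hhk

variable [IsManifold (𝓡 n) ∞ M] {V : Type*} [NormedAddCommGroup V] [NormedSpace ℝ V]

/-- `diff h y` refers to the preferred chart at `y`, which may jump with `y`. Passing to the fixed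
chart at `x` makes continuity arguments possible, and the common factor cancels when two
differentials are compared. -/
theorem diff_eq_fderiv_comp {x y : M} (hy : y ∈ (extChartAt (𝓡 n) x).source) {h : M → V}
    (hh : ContMDiffAt (𝓡 n) 𝓘(ℝ, V) ∞ h y) (v : Euc n) :
    diff h y v = fderiv ℝ (chartRep x h) (extChartAt (𝓡 n) x y)
      (mfderiv (𝓡 n) 𝓘(ℝ, Euc n) (extChartAt (𝓡 n) x) y v) := by
  have hev : h =ᶠ[𝓝 y] chartRep x h ∘ extChartAt (𝓡 n) x := by
    filter_upwards [(isOpen_extChartAt_source (I := 𝓡 n) x).mem_nhds hy] with z hz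
    simp only [chartRep, Function.comp_apply]
    rw [(extChartAt (𝓡 n) x).left_inv hz]
  have hu : extChartAt (𝓡 n) x y ∈ (extChartAt (𝓡 n) x).target :=
    (extChartAt (𝓡 n) x).map_source hy
  have hr : ContDiffAt ℝ ∞ (chartRep x h) (extChartAt (𝓡 n) x y) := by
    refine contDiffAt_chartRep hu ?_
    rwa [(extChartAt (𝓡 n) x).left_inv hy]
  have he : MDifferentiableAt (𝓡 n) 𝓘(ℝ, Euc n) (extChartAt (𝓡 n) x) y :=
    (contMDiffAt_extChartAt' (n := ∞) (by rwa [← extChartAt_source (𝓡 n)])).mdifferentiableAt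
      (by simp)
  have h1 := mfderiv_comp y (hr.differentiableAt (by simp)).mdifferentiableAt he
  rw [mfderiv_eq_fderiv] at h1
  have h2 : mfderiv (𝓡 n) 𝓘(ℝ, V) h y =
      mfderiv (𝓡 n) 𝓘(ℝ, V) (chartRep x h ∘ extChartAt (𝓡 n) x) y := hev.mfderiv_eq
  exact DFunLike.congr_fun (h2.trans h1) v

/-- The differential of any smooth map is locally dominated by that of an immersion. -/
theorem exists_local_bound_diff {f : M → Euc m} (hf : ContMDiff (𝓡 n) 𝓘(ℝ, Euc m) ∞ f)
    (hinj : ∀ x, Function.Injective (diff (n := n) f x)) {h : M → V}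
    (hh : ContMDiff (𝓡 n) 𝓘(ℝ, V) ∞ h) (x : M) :
    ∃ C : ℝ, 0 ≤ C ∧ ∀ᶠ y in 𝓝 x, ∀ v : Euc n, ‖diff h y v‖ ≤ C * ‖diff f y v‖ := by
  set u : Euc n := extChartAt (𝓡 n) x x with hu
  have hA : Function.Injective (fderiv ℝ (chartRep x f) u) := by
    have := hinj x
    rwa [diff_eq_fderiv (hf x)] at this
  obtain ⟨K, hK0, hK⟩ := (fderiv ℝ (chartRep x f) u).toLinearMap.exists_antilipschitzWith
    (LinearMap.ker_eq_bot.mpr hA)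
  have hK' : ∀ w, ‖w‖ ≤ K * ‖fderiv ℝ (chartRep x f) u w‖ := fun w => by
    simpa using hK.le_mul_dist w 0
  have hKr : (0 : ℝ) < K := by exact_mod_cast hK0
  have hcf : ContinuousAt (fderiv ℝ (chartRep x f)) u :=
    (contDiffAt_fderiv (smooth_chartRep hf x)).continuousAt
  have hch : ContinuousAt (fderiv ℝ (chartRep x h)) u :=
    (contDiffAt_fderiv (smooth_chartRep hh x)).continuousAt
  -- With lower bound `1/K` for the differential of `f` at `u`, a perturbation below `1/(2K)` still
  -- leaves the lower bound `1/(2K)`.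
  have e1 : ∀ᶠ z in 𝓝 u, dist (fderiv ℝ (chartRep x f) z) (fderiv ℝ (chartRep x f) u) <
      1 / (2 * K) := Metric.tendsto_nhds.mp hcf _ (by positivity)
  have e2 : ∀ᶠ z in 𝓝 u, dist (fderiv ℝ (chartRep x h) z) (fderiv ℝ (chartRep x h) u) < 1 :=
    Metric.tendsto_nhds.mp hch _ one_pos
  refine ⟨(‖fderiv ℝ (chartRep x h) u‖ + 1) * (2 * K), by positivity, ?_⟩
  have ht : Tendsto (extChartAt (𝓡 n) x) (𝓝 x) (𝓝 u) := continuousAt_extChartAt x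
  filter_upwards [ht.eventually e1, ht.eventually e2, extChartAt_source_mem_nhds (I := 𝓡 n) x]
    with y h1 h2 hy v
  rw [diff_eq_fderiv_comp hy (hh y), diff_eq_fderiv_comp hy (hf y)]
  set w : Euc n := mfderiv (𝓡 n) 𝓘(ℝ, Euc n) (extChartAt (𝓡 n) x) y v
  set z : Euc n := extChartAt (𝓡 n) x y
  have h3 : ‖w‖ ≤ 2 * K * ‖fderiv ℝ (chartRep x f) z w‖ := by
    have h4 : ‖fderiv ℝ (chartRep x f) u w‖ ≤
        ‖fderiv ℝ (chartRep x f) z w‖ + 1 / (2 * K) * ‖w‖ := by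
      have h5 : fderiv ℝ (chartRep x f) u w = fderiv ℝ (chartRep x f) z w -
          (fderiv ℝ (chartRep x f) z - fderiv ℝ (chartRep x f) u) w := by simp
      rw [h5]
      refine (norm_sub_le _ _).trans (add_le_add le_rfl ?_)
      refine (ContinuousLinearMap.le_opNorm _ _).trans ?_
      rw [← dist_eq_norm]
      exact mul_le_mul_of_nonneg_right h1.le (norm_nonneg _)
    have h6 := (hK' w).trans (mul_le_mul_of_nonneg_left h4 hKr.le)
    have h7 : (K : ℝ) * (1 / (2 * K) * ‖w‖) = ‖w‖ / 2 := by field_simp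
    rw [mul_add, h7] at h6
    linarith
  have h8 : ‖fderiv ℝ (chartRep x h) z‖ ≤ ‖fderiv ℝ (chartRep x h) u‖ + 1 := by
    have := norm_le_norm_add_norm_sub' (fderiv ℝ (chartRep x h) z) (fderiv ℝ (chartRep x h) u)
    rw [← dist_eq_norm] at this
    linarith
  calc ‖fderiv ℝ (chartRep x h) z w‖ ≤ ‖fderiv ℝ (chartRep x h) z‖ * ‖w‖ :=
        ContinuousLinearMap.le_opNorm _ _
    _ ≤ (‖fderiv ℝ (chartRep x h) u‖ + 1) * (2 * K * ‖fderiv ℝ (chartRep x f) z w‖) :=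
        mul_le_mul h8 h3 (norm_nonneg _) (by positivity)
    _ = _ := by ring

theorem exists_compact_bound_diff {f : M → Euc m} (hf : ContMDiff (𝓡 n) 𝓘(ℝ, Euc m) ∞ f)
    (hinj : ∀ x, Function.Injective (diff (n := n) f x)) {h : M → V}
    (hh : ContMDiff (𝓡 n) 𝓘(ℝ, V) ∞ h) {K : Set M} (hK : IsCompact K) :
    ∃ C : ℝ, 0 ≤ C ∧ ∀ y ∈ K, ∀ v : Euc n, ‖diff h y v‖ ≤ C * ‖diff f y v‖ := by
  refine hK.induction_on (p := fun s => ∃ C : ℝ, 0 ≤ C ∧ ∀ y ∈ s, ∀ v : Euc n,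
    ‖diff h y v‖ ≤ C * ‖diff f y v‖) ⟨0, le_rfl, by simp⟩ ?_ ?_ ?_
  · rintro s t hst ⟨C, hC, h1⟩
    exact ⟨C, hC, fun y hy => h1 y (hst hy)⟩
  · rintro s t ⟨C, hC, h1⟩ ⟨D, hD, h2⟩
    refine ⟨C + D, add_nonneg hC hD, ?_⟩
    rintro y (hy | hy) v
    · exact (h1 y hy v).trans (mul_le_mul_of_nonneg_right (by linarith) (norm_nonneg _))
    · exact (h2 y hy v).trans (mul_le_mul_of_nonneg_right (by linarith) (norm_nonneg _))
  · intro x _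
    obtain ⟨C, hC, h1⟩ := exists_local_bound_diff hf hinj hh x
    exact ⟨_, mem_nhdsWithin_of_mem_nhds h1, C, hC, fun y hy => hy⟩

/-- Compactness of the support gives the bounds there; elsewhere `χ` and its differential vanish. -/
theorem exists_bound_of_compact_support {f : M → Euc m} (hf : ContMDiff (𝓡 n) 𝓘(ℝ, Euc m) ∞ f)
    (hinj : ∀ x, Function.Injective (diff (n := n) f x)) {T : M → V}
    (hT : ContMDiff (𝓡 n) 𝓘(ℝ, V) ∞ T) {χ : M → ℝ} (hχ : ContMDiff (𝓡 n) 𝓘(ℝ, ℝ) ∞ χ)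
    (hK : IsCompact (tsupport χ)) :
    ∃ C : ℝ, 0 ≤ C ∧ ∀ (y : M) (v : Euc n),
      |χ y| * ‖diff T y v‖ ≤ C * ‖diff f y v‖ ∧ |diff χ y v| * ‖T y‖ ≤ C * ‖diff f y v‖ := by
  obtain ⟨C1, hC1, h1⟩ := exists_compact_bound_diff hf hinj hT hK
  obtain ⟨C2, hC2, h2⟩ := exists_compact_bound_diff hf hinj hχ hK
  obtain ⟨D1, h3⟩ := hK.exists_bound_of_continuousOn hχ.continuous.continuousOn
  obtain ⟨D2, h4⟩ := hK.exists_bound_of_continuousOn hT.continuous.continuousOn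
  refine ⟨|D1| * C1 + C2 * |D2|, by positivity, fun y v => ?_⟩
  by_cases hy : y ∈ tsupport χ
  · have a1 := h1 y hy v
    have a2 := h2 y hy v
    have a3 := (h3 y hy).trans (le_abs_self D1)
    have a4 := (h4 y hy).trans (le_abs_self D2)
    rw [Real.norm_eq_abs] at a2 a3
    constructor
    · calc |χ y| * ‖diff T y v‖ ≤ |D1| * (C1 * ‖diff f y v‖) :=
            mul_le_mul a3 a1 (norm_nonneg _) (abs_nonneg _)
        _ ≤ (|D1| * C1 + C2 * |D2|) * ‖diff f y v‖ := by
            have : 0 ≤ C2 * |D2| * ‖diff f y v‖ := by positivity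
            linarith
    · calc |diff χ y v| * ‖T y‖ ≤ (C2 * ‖diff f y v‖) * |D2| :=
            mul_le_mul a2 a4 (norm_nonneg _) (by positivity)
        _ ≤ (|D1| * C1 + C2 * |D2|) * ‖diff f y v‖ := by
            have : 0 ≤ |D1| * C1 * ‖diff f y v‖ := by positivity
            linarith
  · have b1 : χ y = 0 := image_eq_zero_of_notMem_tsupport hy
    have b2 : diff χ y v = 0 := by
      have hev : χ =ᶠ[𝓝 y] fun _ => (0 : ℝ) := notMem_tsupport_iff_eventuallyEq.mp hy
      have h5 : mfderiv (𝓡 n) 𝓘(ℝ, ℝ) χ y = mfderiv (𝓡 n) 𝓘(ℝ, ℝ) (fun _ => (0 : ℝ)) y :=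
        hev.mfderiv_eq
      rw [mfderiv_const] at h5
      exact DFunLike.congr_fun h5 v
    rw [b1, b2]
    simp only [abs_zero, zero_mul]
    exact ⟨by positivity, by positivity⟩

/-- There are smooth positive functions that are, together with their differentials, as small as
prescribed by a field along an immersion. -/
theorem exists_small_pos_function [T2Space M] [SigmaCompactSpace M] {f : M → Euc m}
    (hf : ContMDiff (𝓡 n) 𝓘(ℝ, Euc m) ∞ f)
    (hinj : ∀ x, Function.Injective (diff (n := n) f x)) {T : M → V}
    (hT : ContMDiff (𝓡 n) 𝓘(ℝ, V) ∞ T) :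
    ∃ δ : M → ℝ, ContMDiff (𝓡 n) 𝓘(ℝ, ℝ) ∞ δ ∧ (∀ x, 0 < δ x) ∧ ∀ (x : M) (v : Euc n),
      δ x * ‖diff T x v‖ + |diff δ x v| * ‖T x‖ ≤ ‖diff f x v‖ / 2 := by
  have : LocallyCompactSpace M := ChartedSpace.locallyCompactSpace (Euc n) M
  choose K hK hKx using fun x : M => exists_compact_mem_nhds x
  obtain ⟨φ, hφ⟩ := SmoothPartitionOfUnity.exists_isSubordinate (𝓡 n) (isClosed_univ (X := M))
    (fun x => interior (K x)) (fun x => isOpen_interior)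
    (fun x _ => mem_iUnion.mpr ⟨x, mem_interior_iff_mem_nhds.mpr (hKx x)⟩)
  have hcomp : ∀ i, IsCompact (tsupport (φ i)) := fun i =>
    (hK i).of_isClosed_subset (isClosed_tsupport _) ((hφ i).trans interior_subset)
  choose C hC0 hC using fun i =>
    exists_bound_of_compact_support hf hinj hT (φ i).contMDiff (hcomp i)
  have hfin : ∀ i, {j | (tsupport (φ j) ∩ tsupport (φ i)).Nonempty}.Finite := fun i =>
    φ.locallyFinite.closure.finite_nonempty_inter_compact (hcomp i)
  -- `N i` counts the supports that meet the support of `φ i`. At any `x`, at most `N i` supports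
  -- contain `x` whenever the `i`-th does, so these weights bound the sum of `c i * C i` by `1/4`.
  -- The added ones avoid zero denominators.
  let N : M → ℕ := fun i => (hfin i).toFinset.card
  let c : M → ℝ := fun i => 1 / (4 * (C i + 1) * (N i + 1))
  have hc0 : ∀ i, 0 < c i := fun i => by
    have := hC0 i
    positivity
  have hcC : ∀ i, c i * C i ≤ 1 / (4 * (N i + 1)) := fun i => by
    have := hC0 i
    rw [div_mul_eq_mul_div, div_le_div_iff₀ (by positivity) (by positivity)]
    have h5 : (0 : ℝ) ≤ 4 * (N i + 1) := by positivity
    linarith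
  let δ : M → ℝ := fun x => ∑ᶠ i, φ i x • c i
  have hδ : ContMDiff (𝓡 n) 𝓘(ℝ, ℝ) ∞ δ :=
    φ.contMDiff_finsum_smul fun i x _ => contMDiffAt_const
  have hsum : ∀ x, δ =ᶠ[𝓝 x] fun y => ∑ i ∈ φ.fintsupport x, c i * φ i y := by
    intro x
    filter_upwards [φ.eventually_finsupport_subset x] with y hy
    simp only [δ]
    rw [finsum_eq_sum_of_support_subset (s := φ.fintsupport x)]
    · exact Finset.sum_congr rfl fun i _ => by rw [smul_eq_mul, mul_comm]
    · intro i hi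
      refine hy ?_
      rw [SmoothPartitionOfUnity.mem_finsupport]
      exact left_ne_zero_of_smul hi
  have hdiff : ∀ x (v : Euc n),
      diff δ x v = ∑ i ∈ φ.fintsupport x, c i * diff (φ i) x v := by
    intro x v
    rw [diff_eq_fderiv (hδ x), (chartRep_eventuallyEq (hsum x)).fderiv_eq]
    have h1 : HasFDerivAt (fun u => ∑ i ∈ φ.fintsupport x, c i * chartRep x (φ i) u)
        (∑ i ∈ φ.fintsupport x, c i • fderiv ℝ (chartRep x (φ i)) (extChartAt (𝓡 n) x x))
        (extChartAt (𝓡 n) x x) :=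
      HasFDerivAt.fun_sum fun i _ =>
        (((smooth_chartRep (φ i).contMDiff x).differentiableAt (by simp)).hasFDerivAt.const_mul
          (c i))
    have h2 : chartRep (n := n) x (fun y => ∑ i ∈ φ.fintsupport x, c i * φ i y) =
        fun u => ∑ i ∈ φ.fintsupport x, c i * chartRep x (φ i) u := rfl
    rw [h2, h1.fderiv]
    simp only [_root_.sum_apply, _root_.smul_apply, smul_eq_mul]
    exact Finset.sum_congr rfl fun i _ => by rw [diff_eq_fderiv ((φ i).contMDiff x)]
  have hcard : ∀ x, ∑ i ∈ φ.fintsupport x, c i * C i ≤ 1 / 4 := by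
    intro x
    rcases (φ.fintsupport x).eq_empty_or_nonempty with h0 | h0
    · rw [h0]; simp
    have hpos : (0 : ℝ) < (φ.fintsupport x).card := by exact_mod_cast h0.card_pos
    calc ∑ i ∈ φ.fintsupport x, c i * C i
        ≤ ∑ i ∈ φ.fintsupport x, 1 / (4 * ((φ.fintsupport x).card : ℝ)) := by
          refine Finset.sum_le_sum fun i hi => (hcC i).trans ?_
          have h1 : (φ.fintsupport x).card ≤ N i := by
            refine Finset.card_le_card fun j hj => ?_
            rw [Set.Finite.mem_toFinset]
            exact ⟨x, (φ.mem_fintsupport_iff x j).mp hj, (φ.mem_fintsupport_iff x i).mp hi⟩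
          have h2 : ((φ.fintsupport x).card : ℝ) ≤ N i := by exact_mod_cast h1
          exact one_div_le_one_div_of_le (by positivity) (by linarith)
      _ = 1 / 4 := by
          rw [Finset.sum_const, nsmul_eq_mul]
          field_simp
  refine ⟨δ, hδ, fun x => ?_, fun x v => ?_⟩
  · rw [(hsum x).eq_of_nhds]
    obtain ⟨i, hi⟩ := φ.exists_pos_of_mem (mem_univ x)
    refine Finset.sum_pos' (fun j _ => mul_nonneg (hc0 j).le (φ.nonneg j x)) ⟨i, ?_, ?_⟩
    · rw [SmoothPartitionOfUnity.mem_fintsupport_iff]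
      exact subset_tsupport _ hi.ne'
    · exact mul_pos (hc0 i) hi
  · have h1 : δ x * ‖diff T x v‖ ≤ 1 / 4 * ‖diff f x v‖ := by
      rw [(hsum x).eq_of_nhds, Finset.sum_mul]
      refine le_trans ?_ (mul_le_mul_of_nonneg_right (hcard x) (norm_nonneg _))
      rw [Finset.sum_mul]
      refine Finset.sum_le_sum fun i _ => ?_
      rw [mul_assoc, mul_assoc]
      have := (hC i x v).1
      rw [abs_of_nonneg (φ.nonneg i x)] at this
      exact mul_le_mul_of_nonneg_left this (hc0 i).le
    have h2 : |diff δ x v| * ‖T x‖ ≤ 1 / 4 * ‖diff f x v‖ := by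
      rw [hdiff]
      refine (mul_le_mul_of_nonneg_right (Finset.abs_sum_le_sum_abs _ _) (norm_nonneg _)).trans ?_
      rw [Finset.sum_mul]
      refine le_trans ?_ (mul_le_mul_of_nonneg_right (hcard x) (norm_nonneg _))
      rw [Finset.sum_mul]
      refine Finset.sum_le_sum fun i _ => ?_
      rw [abs_mul, abs_of_pos (hc0 i), mul_assoc, mul_assoc]
      exact mul_le_mul_of_nonneg_left (hC i x v).2 (hc0 i).le
    linarith

end Domination

/-! ### Realizing bendings by variations, and the converse -/

section Realization

open Filter Topology

variable {n m : ℕ} {M : Type*} [TopologicalSpace M] [ChartedSpace (Euc n) M]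
  [IsManifold (𝓡 n) ∞ M]

/-- A reparametrization of time that is bounded by `d`, and whose derivative with respect to `d` is
bounded by `1`. -/
def boundedTime (t d : ℝ) : ℝ := t * d ^ 2 / (d ^ 2 + t ^ 2)

theorem abs_boundedTime_le {t d : ℝ} (hd : 0 < d) : |boundedTime t d| ≤ d := by
  have h0 : 0 < d ^ 2 + t ^ 2 := by positivity
  rw [boundedTime, abs_div, abs_mul, abs_of_pos h0, abs_of_pos (by positivity : 0 < d ^ 2),
    div_le_iff₀ h0]
  have h1 : |t| * d ≤ d ^ 2 + t ^ 2 := by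
    nlinarith [sq_nonneg (|t| - d), sq_abs t, sq_nonneg d, sq_nonneg t]
  nlinarith [mul_le_mul_of_nonneg_left h1 hd.le]

theorem hasDerivAt_boundedTime {t d : ℝ} (hd : 0 < d) :
    HasDerivAt (boundedTime t) (2 * d * t ^ 3 / (d ^ 2 + t ^ 2) ^ 2) d := by
  have h0 : d ^ 2 + t ^ 2 ≠ 0 := by positivity
  have h1 : HasDerivAt (fun d : ℝ => d ^ 2) (2 * d) d := by simpa using hasDerivAt_pow 2 d
  refine ((h1.const_mul t).div (h1.add_const (t ^ 2)) h0).congr_deriv ?_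
  field_simp
  ring

theorem abs_deriv_boundedTime_le {t d : ℝ} (hd : 0 < d) :
    |2 * d * t ^ 3 / (d ^ 2 + t ^ 2) ^ 2| ≤ 1 := by
  have h0 : 0 < d ^ 2 + t ^ 2 := by positivity
  rw [abs_div, abs_of_pos (by positivity : 0 < (d ^ 2 + t ^ 2) ^ 2), div_le_one (by positivity),
    abs_mul, abs_pow, abs_of_pos (by positivity : 0 < 2 * d)]
  have h1 : 2 * d * |t| ≤ d ^ 2 + t ^ 2 := by
    nlinarith [sq_nonneg (|t| - d), sq_abs t]
  have h2 : |t| ^ 2 ≤ d ^ 2 + t ^ 2 := by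
    rw [sq_abs]; nlinarith [sq_nonneg d]
  calc 2 * d * |t| ^ 3 = (2 * d * |t|) * |t| ^ 2 := by ring
    _ ≤ (d ^ 2 + t ^ 2) * (d ^ 2 + t ^ 2) := mul_le_mul h1 h2 (by positivity) h0.le
    _ = _ := by ring

theorem hasDerivAt_boundedTime_zero {d : ℝ} (hd : 0 < d) :
    HasDerivAt (fun t => boundedTime t d) 1 0 := by
  have h0 : d ^ 2 + (0 : ℝ) ^ 2 ≠ 0 := by positivity
  have h1 : HasDerivAt (fun t : ℝ => t ^ 2) (2 * 0) 0 := by simpa using hasDerivAt_pow 2 (0 : ℝ)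
  refine (((hasDerivAt_id (0 : ℝ)).mul_const (d ^ 2)).div (h1.const_add (d ^ 2)) h0).congr_deriv ?_
  have h2 : d ≠ 0 := hd.ne'
  simp only [id_eq]
  field_simp
  ring

/-- Every smooth field along an immersion is the variational field of a variation by immersions. -/
theorem exists_variation [T2Space M] [SigmaCompactSpace M] {f : M → Euc m}
    (hf : ContMDiff (𝓡 n) 𝓘(ℝ, Euc m) ∞ f)
    (hinj : ∀ x, Function.Injective (diff (n := n) f x)) {T : M → Euc m}
    (hT : ContMDiff (𝓡 n) 𝓘(ℝ, Euc m) ∞ T) :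
    ∃ F : ℝ → M → Euc m, IsVariation (n := n) f 1 F ∧ variationalField F = T := by
  obtain ⟨δ, hδ, hδ0, hsmall⟩ := exists_small_pos_function hf hinj hT
  -- The reparametrized time has `t`-derivative `1` at `t = 0`, so the variational field is `T`,
  -- while its bound by `δ` holds for all `t`; the interval `(-1, 1)` is an arbitrary choice.
  refine ⟨fun t x => f x + boundedTime t (δ x) • T x, ⟨one_pos, ?_, ?_, ?_⟩, ?_⟩
  · refine ContMDiff.contMDiffOn ?_
    have h1 : ContMDiff (𝓘(ℝ, ℝ).prod (𝓡 n)) 𝓘(ℝ, ℝ) ∞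
        (fun p : ℝ × M => boundedTime p.1 (δ p.2)) := by
      intro p
      have h2 : ContDiffAt ℝ ∞ (fun q : ℝ × ℝ => boundedTime q.1 q.2) (p.1, δ p.2) := by
        unfold boundedTime
        have h3 : (δ p.2) ^ 2 + p.1 ^ 2 ≠ 0 := by
          have := hδ0 p.2
          positivity
        exact (contDiffAt_fst.mul (contDiffAt_snd.pow 2)).div
          ((contDiffAt_snd.pow 2).add (contDiffAt_fst.pow 2)) h3
      have h4 : ContMDiffAt (𝓘(ℝ, ℝ).prod (𝓡 n)) 𝓘(ℝ, ℝ × ℝ) ∞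
          (fun p : ℝ × M => (p.1, δ p.2)) p :=
        contMDiff_fst.contMDiffAt.prodMk_space (hδ.comp contMDiff_snd).contMDiffAt
      exact ContMDiffAt.comp p h2.contMDiffAt h4
    exact (hf.comp contMDiff_snd).add (h1.smul (hT.comp contMDiff_snd))
  · funext x
    simp [boundedTime]
  · intro t _ x
    have hsm : ContMDiff (𝓡 n) 𝓘(ℝ, Euc m) ∞ (fun x => f x + boundedTime t (δ x) • T x) := by
      have h1 : ContMDiff (𝓡 n) 𝓘(ℝ, ℝ) ∞ (fun x => boundedTime t (δ x)) := by
        intro x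
        have h2 : ContDiffAt ℝ ∞ (boundedTime t) (δ x) := by
          unfold boundedTime
          have h3 : (δ x) ^ 2 + t ^ 2 ≠ 0 := by
            have := hδ0 x
            positivity
          exact (contDiffAt_const.mul (contDiffAt_id.pow 2)).div
            ((contDiffAt_id.pow 2).add contDiffAt_const) h3
        exact ContMDiffAt.comp x h2.contMDiffAt (hδ x)
      exact hf.add (h1.smul hT)
    set u : Euc n := extChartAt (𝓡 n) x x with hu
    have hat : ∀ {V : Type} (h : M → V), chartRep x h u = h x := fun h => by
      simp [chartRep, hu]
    set κ : ℝ := 2 * δ x * t ^ 3 / (δ x ^ 2 + t ^ 2) ^ 2 with hκ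
    have hform : ∀ v : Euc n, diff (fun x => f x + boundedTime t (δ x) • T x) x v =
        diff f x v + (boundedTime t (δ x) • diff T x v + (κ * diff δ x v) • T x) := by
      intro v
      rw [diff_eq_fderiv (hsm x), diff_eq_fderiv (hf x), diff_eq_fderiv (hT x),
        diff_eq_fderiv (hδ x), ← hu]
      have hd : ∀ {V : Type} [NormedAddCommGroup V] [NormedSpace ℝ V] {h : M → V},
          ContMDiff (𝓡 n) 𝓘(ℝ, V) ∞ h →
          HasFDerivAt (chartRep x h) (fderiv ℝ (chartRep x h) u) u := fun hh =>
        ((smooth_chartRep hh x).differentiableAt (by simp)).hasFDerivAt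
      have hb : HasDerivAt (boundedTime t) κ (chartRep x δ u) := by
        rw [hat]
        exact hasDerivAt_boundedTime (hδ0 x)
      have h1 : HasFDerivAt
          (fun z => chartRep x f z + boundedTime t (chartRep x δ z) • chartRep x T z) _ u :=
        (hd hf).add ((hb.comp_hasFDerivAt u (hd hδ)).smul (hd hT))
      have h2 : chartRep (n := n) x (fun x => f x + boundedTime t (δ x) • T x) =
          fun z => chartRep x f z + boundedTime t (chartRep x δ z) • chartRep x T z := rfl
      rw [h2, h1.fderiv]
      simp [hat]
    rw [injective_iff_map_eq_zero]
    intro v hv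
    rw [hform v] at hv
    -- On a kernel vector the differential of `f` equals minus the perturbation. By the choice of
    -- `δ` and the two bounds on `boundedTime`, the perturbation is at most half as large.
    have h1 : ‖diff f x v‖ ≤ ‖diff f x v‖ / 2 := by
      rw [eq_neg_of_add_eq_zero_left hv, norm_neg]
      refine (norm_add_le _ _).trans ?_
      rw [← norm_neg (_ + _), ← eq_neg_of_add_eq_zero_left hv]
      refine le_trans (add_le_add ?_ ?_) (hsmall x v)
      · rw [norm_smul, Real.norm_eq_abs]
        exact mul_le_mul_of_nonneg_right (abs_boundedTime_le (hδ0 x)) (norm_nonneg _)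
      · rw [norm_smul, Real.norm_eq_abs, abs_mul]
        refine mul_le_mul_of_nonneg_right ?_ (norm_nonneg _)
        exact mul_le_of_le_one_left (abs_nonneg _) (abs_deriv_boundedTime_le (hδ0 x))
    have h2 : diff f x v = 0 := norm_eq_zero.mp (le_antisymm (by linarith) (norm_nonneg _))
    exact hinj x (h2.trans (map_zero _).symm)
  · funext x
    have h := ((hasDerivAt_boundedTime_zero (hδ0 x)).smul_const (T x)).const_add (f x)
    rw [one_smul] at h
    exact h.deriv

/-- The variational field of an infinitesimal Moebius variation is a conformal infinitesimal
bending. -/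
theorem IsInfinitesimalMoebiusVariation.exists_bending (hn : 2 ≤ n) {f : M → Euc m}
    (hf : ContMDiff (𝓡 n) 𝓘(ℝ, Euc m) ∞ f)
    (hinj : ∀ x, Function.Injective (diff (n := n) f x))
    (humb : ∀ x : M, ¬ IsUmbilic (n := n) f x) {ε : ℝ} {F : ℝ → M → Euc m}
    (hF : IsInfinitesimalMoebiusVariation (n := n) f ε F) :
    ∃ ρ : M → ℝ, IsConformalInfinitesimalBending (inducedMetric f : BilinField n M) f
        (variationalField F) ρ ∧
      ∀ x : M, laplacian (inducedMetric f : BilinField n M) ρ x +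
        n * inner ℝ (normalizedTraceBeta (inducedMetric f : BilinField n M) f
          (variationalField F) ρ x) (meanCurv (n := n) f x) = 0 := by
  obtain ⟨hV, hmoeb⟩ := hF
  set T := variationalField F with hTdef
  have hT : ContMDiff (𝓡 n) 𝓘(ℝ, Euc m) ∞ T := hV.contMDiff_variationalField
  have hφ0 : ∀ x, phiSq (n := n) f x ≠ 0 := fun x => phiSq_ne_zero hn hf (hinj x) (humb x)
  set φ' : M → ℝ := fun x => deriv (fun t => phiSq (n := n) (F t) x) 0 with hφ'
  have hφd : ∀ x, HasDerivAt (fun t => phiSq (n := n) (F t) x) (φ' x) 0 := fun x =>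
    (hV.differentiableAt_phiSq x).hasDerivAt
  -- Solves `φ²g' + (φ²)'g = 0` for `g' = 2ρg`.
  set ρ : M → ℝ := fun x => -φ' x / (2 * phiSq (n := n) f x) with hρdef
  have hφρ : ∀ x, φ' x = -(2 * phiSq (n := n) f x * ρ x) := fun x => by
    have := hφ0 x
    simp only [hρdef]
    field_simp
  have hbend : ∀ (x : M) (v w : Euc n), inner ℝ (diff T x v) (diff f x w) +
      inner ℝ (diff f x v) (diff T x w) = 2 * ρ x * inducedMetric f x v w := by
    intro x v w
    have h1 := ((hφd x).mul (hV.hasDerivAt_inducedMetric x v w)).unique (hmoeb x v w)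
    rw [hV.zero, hφρ] at h1
    have h2 : phiSq (n := n) f x * (inner ℝ (diff T x v) (diff f x w) +
      inner ℝ (diff f x v) (diff T x w) - 2 * ρ x * inducedMetric f x v w) = 0 := by
      linear_combination h1
    exact sub_eq_zero.mp ((mul_eq_zero.mp h2).resolve_left (hφ0 x))
  -- The definition of `ρ` does not show its smoothness. The bending equation on one fixed nonzero
  -- coordinate direction writes `ρ` near `x` as a quotient of smooth functions.
  have hρ : ContMDiff (𝓡 n) 𝓘(ℝ, ℝ) ∞ ρ := by
    intro x
    refine contMDiffAt_of_chartRep ?_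
    set u : Euc n := extChartAt (𝓡 n) x x
    let e : Euc n := stdVec ⟨0, by omega⟩
    have he : e ≠ 0 := by simp [e, stdVec]
    have hA : fderiv ℝ (chartRep x f) u e ≠ 0 := by
      have h1 := hinj x
      rw [diff_eq_fderiv (hf x)] at h1
      exact fun h => he (h1 (h.trans (map_zero _).symm))
    have hfe : ContDiffAt ℝ ∞ (dirDeriv e (chartRep x f)) u :=
      contDiffAt_dirDeriv (smooth_chartRep hf x) e
    have hTe : ContDiffAt ℝ ∞ (dirDeriv e (chartRep x T)) u :=
      contDiffAt_dirDeriv (smooth_chartRep hT x) e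
    have hA2 : (inner ℝ (dirDeriv e (chartRep x f) u) (dirDeriv e (chartRep x f) u) : ℝ) ≠ 0 :=
      inner_self_ne_zero.mpr hA
    refine ((hTe.inner ℝ hfe).div (hfe.inner ℝ hfe) hA2).congr_of_eventuallyEq ?_
    filter_upwards [extChartAt_target_mem_nhds (I := 𝓡 n) x,
      (hfe.inner ℝ hfe).continuousAt.eventually_ne hA2] with z hz hz0
    have h2 := bending_chart hf hT hbend hz e e
    rw [real_inner_comm (fderiv ℝ (chartRep x T) z e)] at h2
    rw [Pi.div_apply, eq_div_iff hz0]
    simp only [dirDeriv] at h2 ⊢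
    linarith
  have hb : IsConformalInfinitesimalBending (inducedMetric f : BilinField n M) f T ρ :=
    ⟨hT, hρ, hbend⟩
  refine ⟨ρ, hb, fun x => ?_⟩
  have h1 := (hφd x).unique (hasDerivAt_phiSq hn hV hb x)
  rw [hφρ] at h1
  have hn0 : (2 * n : ℝ) ≠ 0 := by positivity
  refine (mul_eq_zero.mp (?_ : (2 * n : ℝ) * _ = 0)).resolve_left hn0
  linear_combination -h1

end Realization

end MoebiusBending

end

/-! ### The main theorem -/

open MoebiusBending in
theorem theorem2 {n m : ℕ} (hn : 2 ≤ n) {M : Type*} [TopologicalSpace M] [T2Space M]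
    [SigmaCompactSpace M] [ChartedSpace (Euc n) M] [IsManifold (𝓡 n) ∞ M]
    (g : Bundle.ContMDiffRiemannianMetric (𝓡 n) ∞ (Euc n) (fun x : M => TangentSpace (𝓡 n) x))
    (f : M → Euc m) (hf : IsIsometricImmersion g.inner f)
    (humb : ∀ x : M, ¬ IsUmbilic (n := n) f x) :
    (IsInfinitesimallyMoebiusBendable n f ↔
      ∃ (T : M → Euc m) (ρ : M → ℝ),
        IsConformalInfinitesimalBending g.inner f T ρ ∧ IsNowhereTrivial f T ∧
        ∀ x : M, laplacian g.inner ρ x +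
          n * inner ℝ (normalizedTraceBeta g.inner f T ρ x) (meanCurv (n := n) f x) = 0) ∧
    (∀ (ε : ℝ) (F : ℝ → M → Euc m) (ρ : M → ℝ),
      IsVariation (n := n) f ε F →
      IsConformalInfinitesimalBending g.inner f (variationalField F) ρ →
      ∀ x : M, HasDerivAt (fun t => phiSq (n := n) (F t) x)
        (2 * n * laplacian g.inner ρ x - 2 * phiSq (n := n) f x * ρ x +
          2 * n ^ 2 * inner ℝ (normalizedTraceBeta g.inner f (variationalField F) ρ x)
            (meanCurv (n := n) f x)) 0) := by
  obtain ⟨hsm, hiso⟩ := hf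
  have hinj : ∀ x, Function.Injective (diff (n := n) f x) := by
    intro x
    rw [injective_iff_map_eq_zero]
    intro v hv
    by_contra h0
    have h1 : 0 < g.inner x v v := g.pos x v h0
    have h2 : inducedMetric f x v v = 0 := by
      change inner ℝ (diff (n := n) f x v) (diff (n := n) f x v) = (0 : ℝ)
      rw [hv, inner_zero_left]
    have h3 := hiso x v v
    rw [h2] at h3
    exact h1.ne h3
  -- The given metric is the induced one, so the results for `inducedMetric f` apply.
  have hg : (g.inner : BilinField n M) = inducedMetric f := by
    funext x
    ext v w
    exact (hiso x v w).symm
  rw [hg]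
  refine ⟨⟨?_, ?_⟩, fun ε F ρ hF hT x => hasDerivAt_phiSq hn hF hT x⟩
  · rintro ⟨ε, F, hF, hnt⟩
    obtain ⟨ρ, hb, heq⟩ := hF.exists_bending hn hsm hinj humb
    exact ⟨variationalField F, ρ, hb, hnt, heq⟩
  · rintro ⟨T, ρ, hb, hnt, heq⟩
    obtain ⟨F, hF, rfl⟩ := exists_variation hsm hinj hb.smooth
    refine ⟨1, F, ⟨hF, fun x v w => ?_⟩, hnt⟩
    -- In the product rule `-2φ²ρ` cancels against `φ²` times the `2ρ` from the metric, leaving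
    -- `2n(Δρ + n⟨ℒ,ℋ⟩)g`.
    refine ((hasDerivAt_phiSq hn hF hb x).mul (hF.hasDerivAt_inducedMetric x v w)).congr_deriv ?_
    rw [hb.bending x v w, hF.zero]
    linear_combination 2 * n * inducedMetric f x v w * heq x
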